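/- **Setting.** Let $G=(V,E)$ be a finite nonempty strongly connected directed graph, $E\subseteq V\times V$. For $i\in V$ let $f_i:\mathbb R^m\to\mathbb R\cup\{\infty\}$ be closed proper convex and $\bar x_i\in\mathbb R^m$, and put $\bar m=\frac1{|V|}\sum_{i\in V}\bar x_i$. The primal problem is $$\min_{x\in\mathbb R^m}\ \sum_{i\in V}\Big[f_i(x)+\tfrac12\|x-\bar x_i\|^2\Big].\tag{P}$$ Let $I=V\cup E\cup\{r\}$ with an extra index $r$, and let $F$ be the set of unordered pairs $\{i,(i,j)\}$, $\{j,(i,j)\}$ for $(i,j)\in E$ and $\{r,\alpha\}$ for $\alpha\in V\cup E$. For $\mathbf x\in[\mathbb R^m]^{I}$ put $\mathbf f_i(\mathbf x)=f_i([\mathbf x]_i)$, and let $H_{\{\alpha_1,\alpha_2\}}=\{\mathbf x:[\mathbf x]_{\alpha_1}=[\mathbf x]_{\alpha_2}\}$. Write $g^*$ for the Fenchel conjugate of $g$ and $\delta_A$ for the indicator function of $A$. Weights $s=(s_\alpha)_{\alpha\in I}$ are admissible if $\sum_\alpha s_\alpha=|V|$, $s_\alpha>0$ for $\alpha\in V$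 and $s_\alpha\ge0$ for $\alpha\in E\cup\{r\}$. The dual problem with weights $s$ is $$\inf_{\mathbf z_\gamma\in[\mathbb R^m]^I,\ \gamma\in V\cup F}\ \sum_{i\in V}\mathbf f_i^*(\mathbf z_i)+\sum_{\beta\in F}\delta_{H_\beta^\perp}(\mathbf z_\beta)+\sum_{\alpha\in I}\frac{s_\alpha}2\Big\|\bar m-\frac1{s_\alpha}\Big[\sum_{\gamma\in V\cup F}\mathbf z_\gamma\Big]_\alpha\Big\|^2,\tag{D$_s$}$$ where the term of an index $\alpha$ with $s_\alpha=0$ is read as $\delta_{\{0\}}\big([\sum_\gamma\mathbf z_\gamma]_\alpha\big)$. **Algorithm.** The state consists of $y_i,z_i,\sigma_{i,y}\in\mathbb R^m$ and $s_i,\sigma_{i,s}\in\mathbb R$ for $i\in V$, and of $\rho_{e,y}\in\mathbb R^m$ and $\rho_{e,s}\in\mathbb R$ for $e\in E$. At the start $\sum_iy_i^0=|V|\bar m$, $s_i^0=1$, and all other quantities are $0$. Each iteration performs one of the following operations. * **A** at a node $i$: $y_i:=y_i/(\mathrm{outdeg}(i)+1)$ and $s_i:=s_i/(\mathrm{outdeg}(i)+1)$;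 then $\sigma_{i,y}:=\sigma_{i,y}+y_i$ and $\sigma_{i,s}:=\sigma_{i,s}+s_i$. * **B** on an edge $e=(i,j)$: $y_j:=y_j+\sigma_{i,y}-\rho_{e,y}$ and $s_j:=s_j+\sigma_{i,s}-\rho_{e,s}$; then $\rho_{e,y}:=\sigma_{i,y}$ and $\rho_{e,s}:=\sigma_{i,s}$. * **C** at a node $j$: with $x_{\rm temp}=\frac1{s_j}(y_j+z_j)$, replace $z_j$ by the minimizer of $\frac{s_j}2\|x_{\rm temp}-\frac1{s_j}z\|^2+f_j^*(z)$ over $z\in\mathbb R^m$; then $y_j:=s_jx_{\rm temp}-z_j$. The superscript $k$ denotes values after $k$ iterations. Put $s_{(i,j)}=\sigma_{i,s}-\rho_{(i,j),s}$, $y_{(i,j)}=\sigma_{i,y}-\rho_{(i,j),y}$, $s_r=0$, $y_r=0$, and $x_\alpha=y_\alpha/s_\alpha$ (irrelevant if $s_\alpha=0$). Let $\mathbf z_i^k$ have $i$-th component $z_i^k$ and all other components $0$. Call $(\mathbf z_\beta^k)_{\beta\in F}$ compatible if $\mathbf z^k_\beta\in H_\beta^\perp$ for all $\beta\in F$ and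 $\bar m-\frac1{s^k_\alpha}[\sum_{\gamma\in V\cup F}\mathbf z_\gamma^k]_\alpha=x_\alpha^k$ whenever $s_\alpha^k>0$. For such a choice let $T^k=(s^k,y^k,x^k,\mathbf z^k)$ and $$\mathrm{Val}(T^k)=\sum_{i\in V}\mathbf f_i^*(\mathbf z_i^k)+\sum_{\beta\in F}\delta_{H_\beta^\perp}(\mathbf z_\beta^k)+\sum_{\alpha\in V\cup E}\frac{s_\alpha^k}2\|x_\alpha^k\|^2\in\mathbb R\cup\{\infty\}.$$ **Theorem.** Suppose there is $\bar\epsilon>0$ with $s_i^k>\bar\epsilon$ for all $k\ge0$ and $i\in V$, the sequences $(z_i^k)_k$, $i\in V$, are bounded, and there is $K$ such that in any $K$ consecutive iterations operations A and C are performed at every node, and operation B on every edge, at least once. Then: 1. For every $k$ there is a compatible choice of $(\mathbf z^k_\beta)_{\beta\in F}$, even one with $\mathbf z^k_{\{r,\alpha\}}=0$ for all $\alpha\in V\cup E$. 2. For all compatible choices, $(\mathrm{Val}(T^k))_k$ is nonincreasing and converges to the optimal value of (D$_s$), for every choice of admissible weights $s$. 3. Problem (P) has a unique minimizer $x^*$,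 its value there is finite, and $x_i^k\to x^*$ as $k\to\infty$ for every $i\in V$. -/

import Mathlib

open Filter Topology

noncomputable section

namespace DualAscent

/-- The decision space `ℝ^m` with its Euclidean norm. -/
abbrev Vec (m : ℕ) : Type := EuclideanSpace ℝ (Fin m)

/-- The index set `V ∪ E ∪ {r}`; the extra index `r` is `none`. -/
abbrev Idx {V : Type*} (E : Finset (V × V)) : Type _ := Option (V ⊕ E)

/-- The index of a node. -/
abbrev node {V : Type*} {E : Finset (V × V)} (i : V) : Idx E := some (Sum.inl i)

/-- The index of an edge. -/
abbrev edge {V : Type*} {E : Finset (V × V)} (e : E) : Idx E := some (Sum.inr e)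

/-- The product space `[ℝ^m]^{V ∪ E ∪ {r}}` as an inner product space. -/
abbrev ProdSpace {V : Type*} (E : Finset (V × V)) (m : ℕ) : Type _ :=
  PiLp 2 (fun _ : Idx E => Vec m)

/-- The directed graph `(V, E)` is strongly connected. -/
def StronglyConnected {V : Type*} (E : Finset (V × V)) : Prop :=
  ∀ i j : V, Relation.ReflTransGen (fun a b => (a, b) ∈ E) i j

/-- Number of edges leaving `i`. -/
def outdeg {V : Type*} [DecidableEq V] (E : Finset (V × V)) (i : V) : ℕ :=
  (E.filter (fun e => e.1 = i)).card

/-! ### Convex analysis -/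

/-- Closed proper convex functions with values in `ℝ ∪ {∞}`. -/
structure IsClosedProperConvex {X : Type*} [TopologicalSpace X] [AddCommMonoid X] [Module ℝ X]
    (f : X → EReal) : Prop where
  ne_bot : ∀ x, f x ≠ ⊥
  proper : ∃ x, f x ≠ ⊤
  convex : Convex ℝ {p : X × ℝ | f p.1 ≤ (p.2 : EReal)}
  closed : LowerSemicontinuous f

/-- The Fenchel conjugate `f^*(z) = sup_x ⟨x, z⟩ - f(x)`. -/
def conj {X : Type*} [NormedAddCommGroup X] [InnerProductSpace ℝ X] (f : X → EReal) (z : X) :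
    EReal :=
  ⨆ x : X, ((inner ℝ x z : ℝ) : EReal) - f x

open Classical in
/-- The indicator function `δ_A`. -/
def indic {X : Type*} (A : Set X) (x : X) : EReal := if x ∈ A then 0 else ⊤

/-! ### The problems -/

section Problems

variable {V : Type*} [Fintype V] [DecidableEq V] {E : Finset (V × V)} {m : ℕ}

/-- The objective `∑ i, f_i(x) + ½‖x - x̄_i‖²` of the distributed optimization problem. -/
def primalObj (f : V → Vec m → EReal) (xbar : V → Vec m) (x : Vec m) : EReal :=
  ∑ i, (f i x + ((1 / 2 * ‖x - xbar i‖ ^ 2 : ℝ) : EReal))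

/-- The average `m̄` of the `x̄_i`. -/
def mean (xbar : V → Vec m) : Vec m := ((Fintype.card V : ℝ))⁻¹ • ∑ i, xbar i

/-- The lift `𝐟_i(𝐱) = f_i([𝐱]_i)` to the product space. -/
def lift (f : V → Vec m → EReal) (i : V) (x : ProdSpace E m) : EReal := f i (x (node i))

/-- The set `F` of unordered pairs `{i,(i,j)}`, `{j,(i,j)}` for `(i,j) ∈ E`, and `{r,α}` for
`α ∈ V ∪ E`. -/
def pairs (E : Finset (V × V)) : Finset (Sym2 (Idx E)) :=
  (Finset.univ.image (fun e : E => s(node e.1.1, edge e))) ∪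
  (Finset.univ.image (fun e : E => s(node e.1.2, edge e))) ∪
  (Finset.univ.image (fun a : V ⊕ E => s((none : Idx E), some a)))

/-- The subspace `H_{{α₁,α₂}} = {𝐱 : x_{α₁} = x_{α₂}}`. -/
def hyper (m : ℕ) (b : Sym2 (Idx E)) : Submodule ℝ (ProdSpace E m) where
  carrier := {x | ∀ a ∈ b, ∀ c ∈ b, x a = x c}
  add_mem' := by
    intro x y hx hy a ha c hc
    simp [hx a ha c hc, hy a ha c hc]
  zero_mem' := by
    intro a _ c _
    rfl
  smul_mem' := by
    intro t x hx a ha c hc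
    simp [hx a ha c hc]

/-- Admissible weights: `∑_α s_α = |V|`, `s_α > 0` on `V` and `s_α ≥ 0` on `E ∪ {r}`. -/
structure IsWeight (s : Idx E → ℝ) : Prop where
  sum_eq : ∑ a, s a = Fintype.card V
  node_pos : ∀ i : V, 0 < s (node i)
  nonneg : ∀ a, 0 ≤ s a

/-- The term `(s/2)‖m̄ - w/s‖²` of the dual objective. For `s = 0` it is, as the Fenchel conjugate
of the zero function, the indicator function of `{0}`. -/
def quad (s : ℝ) (mbar w : Vec m) : EReal :=
  if s = 0 then indic {0} w else ((s / 2 * ‖mbar - s⁻¹ • w‖ ^ 2 : ℝ) : EReal)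

/-- The objective of the dual problem (as a minimization problem) with weights `s`. The term of
the index `r` is kept: if `s_r = 0` it says `[∑ 𝐳]_r = 0`. -/
def dualObj (f : V → Vec m → EReal) (mbar : Vec m) (s : Idx E → ℝ)
    (z : V ⊕ pairs E → ProdSpace E m) : EReal :=
  ∑ i, conj (lift (E := E) f i) (z (Sum.inl i))
    + ∑ b : pairs E, indic ((hyper m b.1)ᗮ : Set (ProdSpace E m)) (z (Sum.inr b))
    + ∑ a, quad (s a) mbar ((∑ c, z c) a)

/-- The optimal value of the dual problem with weights `s`. -/
def dualValue (f : V → Vec m → EReal) (mbar : Vec m) (s : Idx E → ℝ) : EReal :=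
  ⨅ z : V ⊕ pairs E → ProdSpace E m, dualObj f mbar s z

/-- The tuple `T = (s, y, x, 𝐳)`. -/
structure Tuple (E : Finset (V × V)) (m : ℕ) where
  s : Idx E → ℝ
  y : Idx E → Vec m
  x : Idx E → Vec m
  z : V ⊕ pairs E → ProdSpace E m

/-- `Val(T)`. -/
def Val (f : V → Vec m → EReal) (T : Tuple E m) : EReal :=
  ∑ i, conj (lift (E := E) f i) (T.z (Sum.inl i))
    + ∑ b : pairs E, indic ((hyper m b.1)ᗮ : Set (ProdSpace E m)) (T.z (Sum.inr b))
    + ∑ a : V ⊕ E, ((T.s (some a) / 2 * ‖T.x (some a)‖ ^ 2 : ℝ) : EReal)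

end Problems

/-! ### The algorithm -/

section Algorithm

variable {V : Type*} [Fintype V] [DecidableEq V] {E : Finset (V × V)} {m : ℕ}

/-- The data kept by the algorithm; `z i` is `[𝐳_i]_i`. -/
structure State {V : Type*} (E : Finset (V × V)) (m : ℕ) where
  y : V → Vec m
  s : V → ℝ
  z : V → Vec m
  sigY : V → Vec m
  sigS : V → ℝ
  rhoY : E → Vec m
  rhoS : E → ℝ

/-- `s_α` for all indices, with `s_{(i,j)} = σ_{i,s} - ρ_{(i,j),s}` and `s_r = 0`. -/
def State.sAll (S : State E m) : Idx E → ℝ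
  | some (Sum.inl i) => S.s i
  | some (Sum.inr e) => S.sigS e.1.1 - S.rhoS e
  | none => 0

/-- `y_α` for all indices, with `y_{(i,j)} = σ_{i,y} - ρ_{(i,j),y}` and `y_r = 0`. -/
def State.yAll (S : State E m) : Idx E → Vec m
  | some (Sum.inl i) => S.y i
  | some (Sum.inr e) => S.sigY e.1.1 - S.rhoY e
  | none => 0

/-- `x_α = y_α / s_α` (the value is irrelevant where `s_α = 0`). -/
def State.xAll (S : State E m) (a : Idx E) : Vec m := (S.sAll a)⁻¹ • S.yAll a

/-- The tuple of a state, for a choice of the dual variables `𝐳_β`, `β ∈ F`; the dual variable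
`𝐳_i` of a node has the `i`-th component `[𝐳_i]_i` and all others zero. -/
def State.tuple (S : State E m) (zF : pairs E → ProdSpace E m) : Tuple E m where
  s := S.sAll
  y := S.yAll
  x := S.xAll
  z := Sum.elim (fun i => WithLp.toLp 2 (Pi.single (node i) (S.z i))) zF

/-- The dual variables `𝐳_β`, `β ∈ F`, fit the state: `𝐳_β ∈ H_β^⊥`, and
`m̄ - (1/s_α) [∑ 𝐳]_α = x_α` whenever `s_α > 0`. -/
structure Compatible (mbar : Vec m) (S : State E m) (zF : pairs E → ProdSpace E m) : Prop where
  mem_orthogonal : ∀ b, zF b ∈ (hyper m b.1)ᗮ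
  relation : ∀ a : Idx E, 0 < S.sAll a →
    mbar - (S.sAll a)⁻¹ • (∑ c, (S.tuple zF).z c) a = S.xAll a

/-- Starting states. -/
structure State.IsInitial (mbar : Vec m) (S : State E m) : Prop where
  y_sum : ∑ i, S.y i = (Fintype.card V : ℝ) • mbar
  s_eq : ∀ i, S.s i = 1
  z_eq : ∀ i, S.z i = 0
  sigY_eq : ∀ i, S.sigY i = 0
  sigS_eq : ∀ i, S.sigS i = 0
  rhoY_eq : ∀ e, S.rhoY e = 0
  rhoS_eq : ∀ e, S.rhoS e = 0

/-- The three operations with the node or edge they are applied to. -/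
inductive Op {V : Type*} (E : Finset (V × V)) where
  | A (i : V)
  | B (e : E)
  | C (j : V)

/-- Operation `A`: node `i` sends data. -/
def State.send (S : State E m) (i : V) : State E m :=
  let y' := ((outdeg E i : ℝ) + 1)⁻¹ • S.y i
  let s' := S.s i / ((outdeg E i : ℝ) + 1)
  { S with
    y := Function.update S.y i y'
    s := Function.update S.s i s'
    sigY := Function.update S.sigY i (S.sigY i + y')
    sigS := Function.update S.sigS i (S.sigS i + s') }

/-- Operation `B`: the end point of the edge `e` receives data along `e`. -/
def State.receive (S : State E m) (e : E) : State E m :=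
  { S with
    y := Function.update S.y e.1.2 (S.y e.1.2 + S.sigY e.1.1 - S.rhoY e)
    s := Function.update S.s e.1.2 (S.s e.1.2 + S.sigS e.1.1 - S.rhoS e)
    rhoY := Function.update S.rhoY e (S.sigY e.1.1)
    rhoS := Function.update S.rhoS e (S.sigS e.1.1) }

/-- The point `x_temp` of operation `C` at node `j`. -/
def State.xTemp (S : State E m) (j : V) : Vec m := (S.s j)⁻¹ • (S.y j + S.z j)

/-- The function that operation `C` minimizes at node `j`. -/
def State.proxObj (f : V → Vec m → EReal) (S : State E m) (j : V) (z : Vec m) : EReal :=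
  ((S.s j / 2 * ‖S.xTemp j - (S.s j)⁻¹ • z‖ ^ 2 : ℝ) : EReal) + conj (f j) z

/-- `S'` arises from `S` by the given operation. -/
def Step (f : V → Vec m → EReal) : Op E → State E m → State E m → Prop
  | .A i, S, S' => S' = S.send i
  | .B e, S, S' => S' = S.receive e
  | .C j, S, S' => ∃ z : Vec m, IsMinOn (S.proxObj f j) Set.univ z ∧
      S' = { S with
        z := Function.update S.z j z
        y := Function.update S.y j (S.s j • S.xTemp j - z) }

/-- A run of the algorithm: `S k` is the state after `k` iterations, and `op k` is the operation
that leads from `S k` to `S (k + 1)`. -/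
structure IsRun (f : V → Vec m → EReal) (mbar : Vec m) (op : ℕ → Op E) (S : ℕ → State E m) :
    Prop where
  init : (S 0).IsInitial mbar
  step : ∀ k, Step f (op k) (S k) (S (k + 1))

end Algorithm

end DualAscent

end

open DualAscent

/-!
The pairs `(s_α, y_α)` of the nodes and edges always add up to `(|V|, |V| m̄ - ∑ z_i)`. Splitting
such a pair proportionally does not change the value, whereas merging two pairs and the proximal
steps decrease it, each time by at least a constant multiple of the squared displacement of the
`x_i` concerned. The value is bounded below, so all displacements tend to `0`.
As every message is delivered within boundedly many iterations, the `x_i` become equal in the limit,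
and every `z_i` is a subgradient of `f_i` at a point asymptotically equal to `x_i`. By boundedness
of the `z_i` there is a cluster point `(x, z)`, and it satisfies the optimality conditions
`z_i ∈ ∂f_i(x)` and `∑ z_i = |V| (m̄ - x)`.

The difference between the value and the optimal value is the sum of the Fenchel gaps
`f_i^*(z_i) + f_i(x) - ⟪x, z_i⟫` and of the terms `(s_α / 2) ‖x_α - x‖²`. It tends to `0` along a
subsequence, hence altogether, which forces every `x_i` to converge to `x`.
-/

namespace DualAscent

section Sequences

/-- The operation `c` is performed at least once in any `K` consecutive iterations. -/
def Recurs {α : Type*} (op : ℕ → α) (K : ℕ) (c : α) : Prop :=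
  ∀ k, ∃ l, k ≤ l ∧ l < k + K ∧ op l = c

theorem Recurs.exists_of_persists {α : Type*} {op : ℕ → α} {K : ℕ} {c : α} (h : Recurs op K c)
    {P : ℕ → Prop} {k : ℕ} (hk : P k) (hP : ∀ l, op l ≠ c → P l → P (l + 1)) :
    ∃ l, k ≤ l ∧ l < k + K ∧ op l = c ∧ P l := by
  by_contra! hne
  have hPl : ∀ l, k ≤ l → l < k + K → P l := by
    refine Nat.le_induction (fun _ => hk) fun l hl ih hlt => ?_
    have hlK : l < k + K := by omega
    exact hP l (fun hop => hne l hl hlK hop (ih hlK)) (ih hlK)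
  obtain ⟨l, hl, hlK, hop⟩ := h k
  exact hne l hl hlK hop (hPl l hl hlK)

theorem tendsto_zero_of_recurrent {a b d : ℕ → ℝ} {K : ℕ} (ha : ∀ k, 0 ≤ a k)
    (hstep : ∀ k, a (k + 1) ≤ a k + d k) (hd : Tendsto d atTop (𝓝 0))
    (hb : Tendsto b atTop (𝓝 0)) (hrec : ∀ᶠ k in atTop, ∃ l, k ≤ l ∧ l < k + K ∧ a l ≤ b l) :
    Tendsto a atTop (𝓝 0) := by
  have hdrift : ∀ l n, l ≤ n → a n ≤ a l + ∑ j ∈ Finset.Ico l n, d j := fun l =>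
    Nat.le_induction (by simp) fun n hn ih => by
      rw [Finset.sum_Ico_succ_top hn]
      linarith [hstep n]
  have hbound : ∀ᶠ k in atTop, a (k + K) ≤ ∑ j ∈ Finset.range K, (|b (k + j)| + |d (k + j)|) := by
    filter_upwards [hrec] with k ⟨l, hkl, hlK, hab⟩
    have hbl : |b l| ≤ ∑ j ∈ Finset.Ico k (k + K), |b j| :=
      Finset.single_le_sum (fun j _ => abs_nonneg (b j)) (Finset.mem_Ico.2 ⟨hkl, hlK⟩)
    have hdl : ∑ j ∈ Finset.Ico l (k + K), d j ≤ ∑ j ∈ Finset.Ico k (k + K), |d j| :=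
      (Finset.sum_le_sum fun j _ => le_abs_self (d j)).trans <|
        Finset.sum_le_sum_of_subset_of_nonneg (Finset.Ico_subset_Ico_left hkl)
          fun j _ _ => abs_nonneg (d j)
    have hsum : ∑ j ∈ Finset.range K, (|b (k + j)| + |d (k + j)|) =
        ∑ j ∈ Finset.Ico k (k + K), |b j| + ∑ j ∈ Finset.Ico k (k + K), |d j| := by
      rw [← Finset.sum_add_distrib, Finset.sum_Ico_eq_sum_range, Nat.add_sub_cancel_left]
    linarith [hdrift l (k + K) hlK.le, le_abs_self (b l)]
  have hnull :
      Tendsto (fun k => ∑ j ∈ Finset.range K, (|b (k + j)| + |d (k + j)|)) atTop (𝓝 0) := by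
    have hterm : ∀ j ∈ Finset.range K,
        Tendsto (fun k => |b (k + j)| + |d (k + j)|) atTop (𝓝 0) := fun j _ => by
      simpa only [abs_zero, add_zero, Function.comp_def] using
        ((hb.comp (tendsto_add_atTop_nat j)).abs).add ((hd.comp (tendsto_add_atTop_nat j)).abs)
    simpa only [Finset.sum_const_zero] using tendsto_finsetSum _ hterm
  exact (tendsto_add_atTop_iff_nat K).1 <|
    squeeze_zero' (.of_forall fun k => ha (k + K)) hbound hnull

theorem le_sqrt_div_of_mul_sq_le {c a δ : ℝ} (hc : 0 < c) (h : c * a ^ 2 ≤ δ) :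
    a ≤ √(δ / c) :=
  Real.le_sqrt_of_sq_le ((le_div_iff₀' hc).2 h)

theorem tendsto_sqrt_div {δ : ℕ → ℝ} (hδ : Tendsto δ atTop (𝓝 0)) (c : ℝ) :
    Tendsto (fun k => √(δ k / c)) atTop (𝓝 0) := by
  simpa only [zero_div, Real.sqrt_zero] using (hδ.div_const c).sqrt

end Sequences

section ConvexAnalysis

theorem coe_le_of_forall_eq {u : EReal} {c : ℝ} (hu : u ≠ ⊥) (h : ∀ a : ℝ, u = a → c ≤ a) :
    (c : EReal) ≤ u := by
  induction u using EReal.rec with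
  | bot => exact absurd rfl hu
  | top => exact le_top
  | coe a => exact EReal.coe_le_coe_iff.2 (h a rfl)

variable {X : Type*} [NormedAddCommGroup X] [InnerProductSpace ℝ X] {f : X → EReal}

/-- `z` is a subgradient of `f` at `p`; this includes the finiteness of `f p`. -/
def IsSubgrad (f : X → EReal) (p z : X) : Prop :=
  ∃ r : ℝ, f p = r ∧ ∀ x, ((r + inner ℝ z (x - p) : ℝ) : EReal) ≤ f x

theorem IsClosedProperConvex.exists_eq_coe (hf : IsClosedProperConvex f) :
    ∃ (x : X) (r : ℝ), f x = r := by
  obtain ⟨x, hx⟩ := hf.proper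
  exact ⟨x, (f x).toReal, (EReal.coe_toReal hx (hf.ne_bot x)).symm⟩

theorem inner_sub_le_conj {x z : X} {r : ℝ} (hx : f x = r) :
    ((inner ℝ x z - r : ℝ) : EReal) ≤ conj f z := by
  rw [EReal.coe_sub, ← hx]
  exact le_iSup (fun y : X => ((inner ℝ y z : ℝ) : EReal) - f y) x

theorem inner_sub_le_toReal_conj {x z : X} {r : ℝ} (hx : f x = r) (hz : conj f z ≠ ⊤) :
    inner ℝ x z - r ≤ (conj f z).toReal := by
  rw [← EReal.toReal_coe (inner ℝ x z - r)]
  exact EReal.toReal_le_toReal (inner_sub_le_conj hx) (EReal.coe_ne_bot _) hz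

theorem conj_le_coe_iff {z : X} {b : ℝ} :
    conj f z ≤ b ↔ ∀ (x : X) (a : ℝ), f x ≤ a → inner ℝ x z - a ≤ b := by
  refine iSup_le_iff.trans (forall_congr' fun x => ⟨fun h a ha => ?_, fun h => ?_⟩)
  · have hsub := (EReal.sub_le_sub le_rfl ha).trans h
    exact_mod_cast hsub
  · induction hx : f x using EReal.rec with
    | bot =>
      have := h (inner ℝ x z - b - 1) (by simp [hx])
      linarith
    | top => simp
    | coe a => exact_mod_cast h a hx.le

theorem IsSubgrad.conj_eq {p z : X} {r : ℝ} (h : IsSubgrad f p z) (hp : f p = r) :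
    conj f z = ((inner ℝ p z - r : ℝ) : EReal) := by
  obtain ⟨r', hr', hle⟩ := h
  obtain rfl : r' = r := by exact_mod_cast hr'.symm.trans hp
  refine le_antisymm (conj_le_coe_iff.2 fun x a hxa => ?_) (inner_sub_le_conj hp)
  have hxr : r' + inner ℝ z (x - p) ≤ a := by exact_mod_cast (hle x).trans hxa
  rw [inner_sub_right, real_inner_comm x, real_inner_comm p] at hxr
  linarith

theorem IsSubgrad.conj_ne_top {p z : X} (h : IsSubgrad f p z) : conj f z ≠ ⊤ := by
  obtain ⟨r, hr, -⟩ := id h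
  exact (h.conj_eq hr).trans_ne (EReal.coe_ne_top _)

theorem IsSubgrad.fenchel_gap_le {p x z w : X} (hp : IsSubgrad f p z) (hx : IsSubgrad f x w) :
    (conj f z).toReal + (f x).toReal - inner ℝ x z ≤ inner ℝ (p - x) (z - w) := by
  obtain ⟨r, hr, -⟩ := id hp
  obtain ⟨r', hr', hle⟩ := hx
  have hpx : r' + inner ℝ w (p - x) ≤ r := by exact_mod_cast (hle p).trans_eq hr
  rw [hp.conj_eq hr, hr', EReal.toReal_coe, EReal.toReal_coe, inner_sub_right (p - x),
    real_inner_comm w (p - x), inner_sub_left]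
  linarith

theorem IsClosedProperConvex.exists_separation [CompleteSpace X] (hf : IsClosedProperConvex f)
    {p : X} {r : ℝ} (hr : (r : EReal) < f p) :
    ∃ (w : X) (β γ : ℝ), 0 ≤ β ∧ (∀ (x : X) (a : ℝ), f x ≤ a → inner ℝ x w - β * a ≤ γ) ∧
      γ < inner ℝ p w - β * r := by
  have hclosed : IsClosed {q : X × ℝ | f q.1 ≤ (q.2 : EReal)} :=
    hf.closed.isClosed_epigraph.preimage
      (continuous_fst.prodMk (continuous_coe_real_ereal.comp continuous_snd))
  obtain ⟨φ, γ, hepi, hp⟩ :=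
    geometric_hahn_banach_closed_point hf.convex hclosed (x := (p, r)) (not_le.2 hr)
  set w : X := (InnerProductSpace.toDual ℝ X).symm (φ.comp (.inl ℝ X ℝ))
  have hφ (x : X) (a : ℝ) : φ (x, a) = inner ℝ x w - -φ (0, 1) * a := by
    have hx : inner ℝ x w = φ (x, 0) := by
      rw [real_inner_comm, InnerProductSpace.toDual_symm_apply]
      rfl
    have hdecomp : (x, a) = (x, 0) + a • ((0, 1) : X × ℝ) := by simp
    rw [hdecomp, map_add, map_smul, hx, smul_eq_mul]
    ring
  refine ⟨w, -φ (0, 1), γ, ?_, fun x a hxa => (hφ x a).symm.trans_le (hepi (x, a) hxa).le,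
    hp.trans_eq (hφ p r)⟩
  obtain ⟨x, c, hx⟩ := hf.exists_eq_coe
  by_contra! hneg
  -- a negative coefficient would make `φ` unbounded on the vertical ray above `(x, c)`
  obtain ⟨t, ht, htγ⟩ : ∃ t : ℝ, 0 ≤ t ∧ γ ≤ φ (x, c + t) := by
    refine ⟨|γ - φ (x, c)| / φ (0, 1), by have := neg_neg_iff_pos.1 hneg; positivity, ?_⟩
    have hcancel : φ (0, 1) * (|γ - φ (x, c)| / φ (0, 1)) = |γ - φ (x, c)| :=
      mul_div_cancel₀ _ (neg_neg_iff_pos.1 hneg).ne'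
    have hxc := hφ x c
    have hxt := hφ x (c + |γ - φ (x, c)| / φ (0, 1))
    linarith [le_abs_self (γ - φ (x, c))]
  refine (hepi (x, c + t) ?_).not_ge htγ
  exact hx.trans_le (EReal.coe_le_coe_iff.2 (le_add_of_nonneg_right ht))

theorem IsClosedProperConvex.exists_conj_ne_top [CompleteSpace X] (hf : IsClosedProperConvex f) :
    ∃ z, conj f z ≠ ⊤ := by
  obtain ⟨p, c, hp⟩ := hf.exists_eq_coe
  have hc : ((c - 1 : ℝ) : EReal) < f p := hp ▸ EReal.coe_lt_coe_iff.2 (sub_one_lt c)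
  obtain ⟨w, β, γ, -, hepi, hγ⟩ := hf.exists_separation hc
  have hβ : 0 < β := by linarith [hepi p c hp.le]
  have hle : conj f (β⁻¹ • w) ≤ ((γ / β : ℝ) : EReal) := conj_le_coe_iff.2 fun x a hxa => by
    rw [real_inner_smul_right, le_div_iff₀ hβ, sub_mul, mul_comm a, mul_right_comm,
      inv_mul_cancel₀ hβ.ne', one_mul]
    exact hepi x a hxa
  exact ⟨β⁻¹ • w, (hle.trans_lt (EReal.coe_lt_top _)).ne⟩

theorem isClosedProperConvex_conj [CompleteSpace X] (hf : IsClosedProperConvex f) :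
    IsClosedProperConvex (conj f) where
  ne_bot z := by
    obtain ⟨x, r, hx⟩ := hf.exists_eq_coe
    exact ((EReal.bot_lt_coe _).trans_le (inner_sub_le_conj hx)).ne'
  proper := hf.exists_conj_ne_top
  convex := by
    rintro ⟨z, b⟩ hz ⟨z', b'⟩ hz' s t hs ht hst
    refine conj_le_coe_iff.2 fun x a hxa => ?_
    have hb := mul_le_mul_of_nonneg_left (conj_le_coe_iff.1 hz x a hxa) hs
    have hb' := mul_le_mul_of_nonneg_left (conj_le_coe_iff.1 hz' x a hxa) ht
    simp only [Prod.fst_add, Prod.snd_add, Prod.smul_fst, Prod.smul_snd, inner_add_right,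
      real_inner_smul_right, smul_eq_mul]
    linear_combination hb + hb' + a * hst
  closed := by
    refine lowerSemicontinuous_iSup fun x => Continuous.lowerSemicontinuous ?_
    induction f x using EReal.rec with
    | bot => simpa using continuous_const
    | top => simpa using continuous_const
    | coe a =>
      simp only [← EReal.coe_sub]
      exact continuous_coe_real_ereal.comp (by fun_prop)

theorem IsClosedProperConvex.isSubgrad_of_conj [CompleteSpace X] (hf : IsClosedProperConvex f)
    {v z : X} (h : IsSubgrad (conj f) z v) : IsSubgrad f v z := by
  obtain ⟨c, hc, hle⟩ := h
  have hyoung (x : X) (a : ℝ) (hxa : f x ≤ a) : inner ℝ x z - a ≤ c :=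
    conj_le_coe_iff.1 hc.le x a hxa
  have hminorant (x : X) : ((inner ℝ x z - c : ℝ) : EReal) ≤ f x :=
    coe_le_of_forall_eq (hf.ne_bot x) fun a ha => by linarith [hyoung x a ha.le]
  have hmajorant : f v ≤ ((inner ℝ v z - c : ℝ) : EReal) := by
    by_contra! hlt
    obtain ⟨w, β, γ, hβ, hepi, hγ⟩ := hf.exists_separation hlt
    -- tilting `z` by the separating functional would violate the subgradient inequality
    have hβ1 : 0 < 1 + β := by linarith
    have htilt : conj f ((1 + β)⁻¹ • (z + w)) ≤ (((1 + β)⁻¹ * (c + γ) : ℝ) : EReal) :=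
      conj_le_coe_iff.2 fun x a hxa => by
        rw [real_inner_smul_right, inner_add_right, ← mul_le_mul_iff_right₀ hβ1, mul_sub,
          mul_inv_cancel_left₀ hβ1.ne', mul_inv_cancel_left₀ hβ1.ne']
        linarith [hyoung x a hxa, hepi x a hxa]
    have hsub : c + inner ℝ v ((1 + β)⁻¹ • (z + w) - z) ≤ (1 + β)⁻¹ * (c + γ) := by
      exact_mod_cast (hle _).trans htilt
    rw [inner_sub_right, real_inner_smul_right, inner_add_right,
      ← mul_le_mul_iff_right₀ hβ1, mul_add, mul_sub, mul_inv_cancel_left₀ hβ1.ne',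
      mul_inv_cancel_left₀ hβ1.ne'] at hsub
    linarith
  refine ⟨inner ℝ v z - c, le_antisymm hmajorant (hminorant v), fun x => ?_⟩
  convert hminorant x using 2
  rw [inner_sub_right, real_inner_comm x, real_inner_comm v]
  ring

theorem IsClosedProperConvex.le_segment (hf : IsClosedProperConvex f) {x y : X} {a b t : ℝ}
    (hx : f x = a) (hy : f y = b) (ht : t ∈ Set.Icc (0 : ℝ) 1) :
    f (x + t • (y - x)) ≤ ((a + t * (b - a) : ℝ) : EReal) := by
  have hmem := hf.convex.add_smul_sub_mem (x := (x, a)) (y := (y, b)) hx.le hy.le ht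
  simpa using hmem

theorem IsClosedProperConvex.isSubgrad_of_isMinOn_quad_add (hf : IsClosedProperConvex f) {s : ℝ}
    (hs : 0 < s) {u z : X}
    (hz : IsMinOn (fun w => ((s / 2 * ‖u - s⁻¹ • w‖ ^ 2 : ℝ) : EReal) + f w) Set.univ z) :
    IsSubgrad f z (u - s⁻¹ • z) := by
  replace hz := isMinOn_univ_iff.1 hz
  obtain ⟨c, hc⟩ : ∃ c : ℝ, f z = c := by
    obtain ⟨x, r, hx⟩ := hf.exists_eq_coe
    have hle := hz x
    induction hfz : f z using EReal.rec with
    | bot => exact absurd hfz (hf.ne_bot z)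
    | top =>
      rw [hfz, hx, EReal.coe_add_top, top_le_iff] at hle
      exact absurd hle (EReal.coe_ne_top _)
    | coe c => exact ⟨c, rfl⟩
  refine ⟨c, hc, fun x => coe_le_of_forall_eq (hf.ne_bot x) fun b hb => ?_⟩
  set v := u - s⁻¹ • z with hv
  have hsegment : ∀ t ∈ Set.Ioo (0 : ℝ) 1,
      c + inner ℝ v (x - z) - b ≤ t * (‖x - z‖ ^ 2 / (2 * s)) := by
    intro t ht
    have hmin : s / 2 * ‖v‖ ^ 2 + c ≤
        s / 2 * ‖u - s⁻¹ • (z + t • (x - z))‖ ^ 2 + (c + t * (b - c)) := by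
      have hseg := hf.le_segment hc hb ⟨ht.1.le, ht.2.le⟩
      have := (hz (z + t • (x - z))).trans (add_le_add_right hseg _)
      rw [hc] at this
      exact_mod_cast this
    have hexpand : ‖u - s⁻¹ • (z + t • (x - z))‖ ^ 2 =
        ‖v‖ ^ 2 - 2 * (s⁻¹ * t * inner ℝ v (x - z)) + (s⁻¹ * t * ‖x - z‖) ^ 2 := by
      rw [smul_add, ← sub_sub, ← hv, smul_smul, norm_sub_sq_real, real_inner_smul_right, norm_smul,
        mul_pow, mul_pow, Real.norm_eq_abs, sq_abs]
    rw [hexpand] at hmin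
    have hquot : s / 2 * (‖v‖ ^ 2 - 2 * (s⁻¹ * t * inner ℝ v (x - z)) + (s⁻¹ * t * ‖x - z‖) ^ 2) =
        s / 2 * ‖v‖ ^ 2 - t * inner ℝ v (x - z) + t * (t * (‖x - z‖ ^ 2 / (2 * s))) := by
      field_simp
    rw [hquot] at hmin
    exact le_of_mul_le_mul_left (by linarith) ht.1
  have hlim : Tendsto (fun t : ℝ => t * (‖x - z‖ ^ 2 / (2 * s))) (𝓝[>] 0) (𝓝 0) :=
    tendsto_nhdsWithin_of_tendsto_nhds ((continuous_mul_const _).tendsto' 0 0 (zero_mul _))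
  linarith [ge_of_tendsto hlim (mem_of_superset (Ioo_mem_nhdsGT one_pos) hsegment)]

theorem IsClosedProperConvex.isSubgrad_of_tendsto (hf : IsClosedProperConvex f) {ι : Type*}
    {l : Filter ι} [l.NeBot] {p z : ι → X} {p₀ z₀ : X} (hp : Tendsto p l (𝓝 p₀))
    (hz : Tendsto z l (𝓝 z₀)) (h : ∀ᶠ k in l, IsSubgrad f (p k) (z k)) :
    IsSubgrad f p₀ z₀ := by
  have hbound (x : X) (b : ℝ) (hb : f x = b) :
      f p₀ ≤ ((b - inner ℝ z₀ (x - p₀) : ℝ) : EReal) := by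
    have hlim : Tendsto (fun k => ((b - inner ℝ (z k) (x - p k) : ℝ) : EReal)) l
        (𝓝 ((b - inner ℝ z₀ (x - p₀) : ℝ) : EReal)) :=
      (continuous_coe_real_ereal.tendsto _).comp
        (tendsto_const_nhds.sub (hz.inner (tendsto_const_nhds.sub hp)))
    refine le_of_forall_lt_imp_le_of_dense fun y hy => ge_of_tendsto hlim ?_
    filter_upwards [h, hp.eventually (hf.closed p₀ y hy)] with k ⟨r, hr, hle⟩ hyk
    have hrb : r + inner ℝ (z k) (x - p k) ≤ b := by exact_mod_cast (hle x).trans_eq hb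
    exact (hyk.le.trans_eq hr).trans (EReal.coe_le_coe_iff.2 (by linarith))
  obtain ⟨r, hr⟩ : ∃ r : ℝ, f p₀ = r := by
    obtain ⟨x, b, hx⟩ := hf.exists_eq_coe
    exact ⟨_, (EReal.coe_toReal ((hbound x b hx).trans_lt (EReal.coe_lt_top _)).ne
      (hf.ne_bot p₀)).symm⟩
  refine ⟨r, hr, fun x => coe_le_of_forall_eq (hf.ne_bot x) fun b hb => ?_⟩
  have := hr ▸ hbound x b hb
  linarith [EReal.coe_le_coe_iff.1 this]

end ConvexAnalysis

section Orthogonality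

theorem exists_mem_orthogonal_sum_eq {F ι : Type*} [NormedAddCommGroup F] [InnerProductSpace ℝ F]
    [FiniteDimensional ℝ F] [Fintype ι] (H : ι → Submodule ℝ F) {w : F} (hw : w ∈ (⨅ b, H b)ᗮ) :
    ∃ z : ι → F, (∀ b, z b ∈ (H b)ᗮ) ∧ ∑ b, z b = w := by
  have hsup : (⨅ b, H b)ᗮ = ⨆ b, (H b)ᗮ := by
    rw [← Submodule.orthogonal_orthogonal (⨆ b, (H b)ᗮ), ← Submodule.iInf_orthogonal]
    simp only [Submodule.orthogonal_orthogonal]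
  obtain ⟨z, hz, hsum⟩ := (Submodule.mem_iSup_iff_exists_finsupp _ _).1 (hsup ▸ hw)
  exact ⟨z, hz, by rw [← hsum, Finsupp.sum_fintype _ _ fun _ => rfl]⟩

variable {V : Type*} {E : Finset (V × V)} {m : ℕ}

theorem mem_hyper_mk_iff {x : ProdSpace E m} {a c : Idx E} : x ∈ hyper m s(a, c) ↔ x a = x c := by
  refine ⟨fun h => h a (Sym2.mem_mk_left a c) c (Sym2.mem_mk_right a c), fun h b hb d hd => ?_⟩
  rcases Sym2.mem_iff.1 hb with rfl | rfl <;> rcases Sym2.mem_iff.1 hd with rfl | rfl <;>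
    simp only [h]

/-- The element of the product space all of whose components are equal to `x`. -/
def diagonal (E : Finset (V × V)) (x : Vec m) : ProdSpace E m := WithLp.toLp 2 fun _ => x

theorem diagonal_mem_hyper (x : Vec m) (b : Sym2 (Idx E)) : diagonal E x ∈ hyper m b :=
  fun _ _ _ _ => rfl

variable [Fintype V]

theorem inner_diagonal (x : Vec m) (w : ProdSpace E m) :
    inner ℝ (diagonal E x) w = inner ℝ x (∑ a, w a) := by
  rw [PiLp.inner_apply, inner_sum]
  rfl

variable [DecidableEq V]

theorem eq_of_forall_mem_hyper (hE : StronglyConnected E) {x : ProdSpace E m}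
    (hx : ∀ b ∈ pairs E, none ∉ b → x ∈ hyper m b) (a c : V ⊕ E) : x (some a) = x (some c) := by
  have hsource (e : E) : x (node e.1.1) = x (edge e) :=
    mem_hyper_mk_iff.1 (hx _ (by simp [pairs]) (by simp))
  have htarget (e : E) : x (node e.1.2) = x (edge e) :=
    mem_hyper_mk_iff.1 (hx _ (by simp [pairs]) (by simp))
  have hnode (i j : V) : x (node i) = x (node j) := by
    induction hE i j with
    | refl => rfl
    | tail _ hij ih => exact ih.trans ((hsource ⟨_, hij⟩).trans (htarget ⟨_, hij⟩).symm)
  rcases a with i | e <;> rcases c with j | e'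
  · exact hnode i j
  · exact (hnode i _).trans (hsource e')
  · exact (hsource e).symm.trans (hnode _ j)
  · exact ((hsource e).symm.trans (hnode _ _)).trans (hsource e')

theorem exists_hyper_orthogonal_sum_eq [Nonempty V] (hE : StronglyConnected E) {w : ProdSpace E m}
    (hw : ∑ a, w a = 0) :
    ∃ zF : pairs E → ProdSpace E m, (∀ b, zF b ∈ (hyper m b.1)ᗮ) ∧ ∑ b, zF b = w := by
  refine exists_mem_orthogonal_sum_eq (fun b : pairs E => hyper m b.1)
    ((Submodule.mem_orthogonal _ _).2 fun x hx => ?_)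
  have hmem : ∀ b ∈ pairs E, x ∈ hyper m b := fun b hb => (Submodule.mem_iInf _).1 hx ⟨b, hb⟩
  obtain ⟨i⟩ := ‹Nonempty V›
  have hconst : x = diagonal E (x (node i)) := by
    ext1 a
    rcases a with _ | a
    · exact mem_hyper_mk_iff.1 (hmem s(none, node i) (by simp [pairs]))
    · exact eq_of_forall_mem_hyper hE (fun b hb _ => hmem b hb) a _
  rw [hconst, inner_diagonal, hw, inner_zero_right]

theorem exists_hyper_orthogonal_sum_eq_of_none [Nonempty V] (hE : StronglyConnected E)
    {w : ProdSpace E m} (hw : ∑ a, w a = 0) (hnone : w none = 0) :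
    ∃ zF : pairs E → ProdSpace E m, (∀ b, zF b ∈ (hyper m b.1)ᗮ) ∧ ∑ b, zF b = w ∧
      ∀ b, none ∈ b.1 → zF b = 0 := by
  classical
  -- the pairs that contain `r` are disabled by taking the whole space instead of `H_β`
  let H (b : pairs E) : Submodule ℝ (ProdSpace E m) := if none ∈ b.1 then ⊤ else hyper m b.1
  have hHnone {b : pairs E} (hb : none ∈ b.1) : H b = ⊤ := if_pos hb
  have hw' : w ∈ (⨅ b, H b)ᗮ := by
    refine (Submodule.mem_orthogonal _ _).2 fun x hx => ?_
    have hmem (b) (hb : b ∈ pairs E) (hb' : none ∉ b) : x ∈ hyper m b := by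
      simpa only [H, if_neg hb'] using (Submodule.mem_iInf _).1 hx ⟨b, hb⟩
    obtain ⟨i⟩ := ‹Nonempty V›
    have hconst (a : Idx E) : inner ℝ (x a) (w a) = inner ℝ (x (node i)) (w a) := by
      rcases a with _ | a
      · rw [hnone, inner_zero_right, inner_zero_right]
      · rw [eq_of_forall_mem_hyper hE hmem a (Sum.inl i)]
    rw [PiLp.inner_apply, Finset.sum_congr rfl fun a _ => hconst a, ← inner_sum, hw,
      inner_zero_right]
  obtain ⟨zF, hzF, hsum⟩ := exists_mem_orthogonal_sum_eq H hw'
  refine ⟨zF, fun b => ?_, hsum, fun b hb => ?_⟩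
  · by_cases hb : none ∈ b.1
    · exact Submodule.orthogonal_le (hHnone hb ▸ le_top) (hzF b)
    · simpa only [H, if_neg hb] using hzF b
  · simpa only [hHnone hb, Submodule.top_orthogonal_eq_bot, Submodule.mem_bot] using hzF b

theorem sum_sum_single (z : V → Vec m) :
    ∑ a, (∑ i, PiLp.single 2 (node i) (z i) : ProdSpace E m) a = ∑ i, z i := by
  simp only [WithLp.ofLp_sum, Finset.sum_apply, PiLp.ofLp_single]
  rw [Finset.sum_comm]
  simp only [Finset.sum_pi_single', Finset.mem_univ, if_true]

end Orthogonality

section Duality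

theorem coe_sum {ι : Type*} (t : Finset ι) (g : ι → ℝ) :
    ((∑ i ∈ t, g i : ℝ) : EReal) = ∑ i ∈ t, (g i : EReal) :=
  map_sum (⟨⟨Real.toEReal, EReal.coe_zero⟩, EReal.coe_add⟩ : ℝ →+ EReal) g t

theorem indic_of_mem {X : Type*} {A : Set X} {x : X} (h : x ∈ A) : indic A x = 0 := if_pos h

theorem coe_inner_le_indic_orthogonal {X : Type*} [NormedAddCommGroup X] [InnerProductSpace ℝ X]
    {H : Submodule ℝ X} {x : X} (hx : x ∈ H) (z : X) :
    ((inner ℝ x z : ℝ) : EReal) ≤ indic (Hᗮ : Set X) z := by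
  by_cases hz : z ∈ (Hᗮ : Set X)
  · rw [indic_of_mem hz, Submodule.inner_right_of_mem_orthogonal hx hz, EReal.coe_zero]
  · exact le_top.trans_eq (if_neg hz).symm

variable {m : ℕ}

theorem le_quad {s : ℝ} (hs : 0 ≤ s) (mbar w x : Vec m) :
    ((s * inner ℝ mbar x - inner ℝ x w - s / 2 * ‖x‖ ^ 2 : ℝ) : EReal) ≤ quad s mbar w := by
  rcases hs.eq_or_lt with rfl | hs
  · by_cases hw : w = 0 <;> simp [quad, indic, hw]
  · obtain ⟨v, rfl⟩ : ∃ v, w = s • (mbar - v) :=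
      ⟨mbar - s⁻¹ • w, by rw [sub_sub_cancel, smul_inv_smul₀ hs.ne']⟩
    have hsq : 0 ≤ s / 2 * ‖v - x‖ ^ 2 := by positivity
    rw [norm_sub_sq_real] at hsq
    rw [quad, if_neg hs.ne', inv_smul_smul₀ hs.ne', sub_sub_cancel, EReal.coe_le_coe_iff,
      real_inner_smul_right, inner_sub_right, real_inner_comm x mbar, real_inner_comm v x]
    linarith

theorem quad_smul_sub (s : ℝ) (mbar x : Vec m) :
    quad s mbar (s • (mbar - x)) = ((s / 2 * ‖x‖ ^ 2 : ℝ) : EReal) := by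
  by_cases hs : s = 0
  · simp [quad, indic, hs]
  · rw [quad, if_neg hs, inv_smul_smul₀ hs, sub_sub_cancel]

variable {V : Type*} [Fintype V]

/-- The lower bound for the dual objectives that weak duality gives at a point `x` where all `f i`
are finite. Up to an additive constant it is the negative of the primal objective. -/
noncomputable def dualBound (f : V → Vec m → EReal) (mbar x : Vec m) : ℝ :=
  Fintype.card V * inner ℝ mbar x - ∑ i, (f i x).toReal - Fintype.card V / 2 * ‖x‖ ^ 2

/-- The optimality conditions: `x` solves the primal problem, and the `z i` are the node components
of a solution of the dual problems. -/
structure IsPrimalDualPair (f : V → Vec m → EReal) (mbar x : Vec m) (z : V → Vec m) : Prop where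
  isSubgrad : ∀ i, IsSubgrad (f i) x (z i)
  sum_eq : ∑ i, z i = (Fintype.card V : ℝ) • (mbar - x)

variable {f : V → Vec m → EReal} {x : Vec m} {z : V → Vec m}

theorem sum_conj_eq_of_isSubgrad (h : ∀ i, IsSubgrad (f i) x (z i)) :
    ∑ i, conj (f i) (z i) =
      ((inner ℝ x (∑ i, z i) - ∑ i, (f i x).toReal : ℝ) : EReal) := by
  rw [inner_sum, ← Finset.sum_sub_distrib, coe_sum]
  refine Finset.sum_congr rfl fun i _ => (h i).conj_eq ?_
  obtain ⟨r, hr, -⟩ := h i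
  rw [hr, EReal.toReal_coe]

section Primal

variable {xbar : V → Vec m}

theorem card_smul_mean [Nonempty V] : (Fintype.card V : ℝ) • mean xbar = ∑ i, xbar i :=
  smul_inv_smul₀ (Nat.cast_ne_zero.2 Fintype.card_ne_zero) _

theorem IsPrimalDualPair.primalObj_growth [Nonempty V]
    (h : IsPrimalDualPair f (mean xbar) x z) : ∃ p : ℝ, primalObj f xbar x = p ∧
      ∀ y, ((p + Fintype.card V / 2 * ‖y - x‖ ^ 2 : ℝ) : EReal) ≤ primalObj f xbar y := by
  choose r hr hle using h.isSubgrad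
  refine ⟨∑ i, (r i + 1 / 2 * ‖x - xbar i‖ ^ 2), by simp only [primalObj, hr, coe_sum,
    EReal.coe_add], fun y => ?_⟩
  have hsubgrad : ((∑ i, (r i + inner ℝ (z i) (y - x) + 1 / 2 * ‖y - xbar i‖ ^ 2) : ℝ) : EReal) ≤
      primalObj f xbar y := by
    rw [coe_sum]
    exact Finset.sum_le_sum fun i _ => (EReal.coe_add _ _).trans_le (add_le_add_left (hle i y) _)
  refine le_of_eq_of_le (congrArg _ ?_) hsubgrad
  have hsquare (i : V) : 1 / 2 * ‖y - xbar i‖ ^ 2 =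
      1 / 2 * ‖x - xbar i‖ ^ 2 - inner ℝ (xbar i - x) (y - x) + 1 / 2 * ‖y - x‖ ^ 2 := by
    rw [← sub_sub_sub_cancel_right y (xbar i) x, norm_sub_sq_real, norm_sub_rev x,
      real_inner_comm]
    ring
  have hsum : ∑ i, z i = ∑ i, (xbar i - x) := by
    rw [h.sum_eq, smul_sub, card_smul_mean, Finset.sum_sub_distrib, Finset.sum_const,
      Finset.card_univ, Nat.cast_smul_eq_nsmul]
  simp only [hsquare, Finset.sum_add_distrib, Finset.sum_sub_distrib, ← sum_inner, hsum,
    Finset.sum_const, Finset.card_univ, nsmul_eq_mul]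
  ring

theorem IsPrimalDualPair.primalObj_ne_top [Nonempty V]
    (h : IsPrimalDualPair f (mean xbar) x z) : primalObj f xbar x ≠ ⊤ := by
  obtain ⟨p, hp, -⟩ := h.primalObj_growth
  exact hp ▸ EReal.coe_ne_top p

theorem IsPrimalDualPair.isMinOn_primalObj_iff [Nonempty V]
    (h : IsPrimalDualPair f (mean xbar) x z) (y : Vec m) :
    IsMinOn (primalObj f xbar) Set.univ y ↔ y = x := by
  obtain ⟨p, hp, hgrowth⟩ := h.primalObj_growth
  rw [isMinOn_univ_iff]
  constructor
  · intro hy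
    have hle : p + Fintype.card V / 2 * ‖y - x‖ ^ 2 ≤ p := by
      exact_mod_cast (hgrowth y).trans ((hy x).trans_eq hp)
    by_contra hne
    have hpos : 0 < ‖y - x‖ := norm_pos_iff.2 (sub_ne_zero.2 hne)
    have : 0 < Fintype.card V / 2 * ‖y - x‖ ^ 2 := by positivity
    linarith
  · rintro rfl w
    refine hp.trans_le (le_trans (EReal.coe_le_coe_iff.2 ?_) (hgrowth w))
    exact le_add_of_nonneg_right (by positivity)

end Primal

variable [DecidableEq V] {E : Finset (V × V)} {mbar : Vec m} {s : Idx E → ℝ}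

theorem conj_lift_single (f : V → Vec m → EReal) (i : V) (v : Vec m) :
    conj (lift (E := E) f i) (PiLp.single 2 (node i) v) = conj (f i) v := by
  have hinner (x : ProdSpace E m) :
      inner ℝ x (PiLp.single 2 (node i) v) = inner ℝ (x (node i)) v := by
    rw [PiLp.inner_apply, Finset.sum_eq_single (node i)]
    · rw [PiLp.single_eq_same]
    · intro a _ ha
      rw [PiLp.single_eq_of_ne _ ha, inner_zero_right]
    · exact fun hi => absurd (Finset.mem_univ _) hi
  have hsurj : Function.Surjective fun x : ProdSpace E m => x (node i) :=
    fun y => ⟨diagonal E y, rfl⟩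
  simp only [conj, hinner]
  exact hsurj.iSup_comp fun y => ((inner ℝ y v : ℝ) : EReal) - f i y

theorem dualBound_le_dualObj (hs : IsWeight s) (hx : ∀ i, ∃ r : ℝ, f i x = r)
    (z : V ⊕ pairs E → ProdSpace E m) : (dualBound f mbar x : EReal) ≤ dualObj f mbar s z := by
  choose r hr using hx
  -- every term is bounded by the Fenchel-Young inequality with the diagonal vector of `x`
  have hconj : ((∑ i, (inner ℝ (diagonal E x) (z (Sum.inl i)) - r i) : ℝ) : EReal) ≤
      ∑ i, conj (lift (E := E) f i) (z (Sum.inl i)) := by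
    rw [coe_sum]
    exact Finset.sum_le_sum fun i _ => inner_sub_le_conj (hr i)
  have hindic : ((∑ b, inner ℝ (diagonal E x) (z (Sum.inr b)) : ℝ) : EReal) ≤
      ∑ b : pairs E, indic ((hyper m b.1)ᗮ : Set (ProdSpace E m)) (z (Sum.inr b)) := by
    rw [coe_sum]
    exact Finset.sum_le_sum fun b _ =>
      coe_inner_le_indic_orthogonal (diagonal_mem_hyper x b.1) _
  have hquad : ((∑ a, (s a * inner ℝ mbar x - inner ℝ x ((∑ c, z c) a) - s a / 2 * ‖x‖ ^ 2) : ℝ) :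
      EReal) ≤ ∑ a, quad (s a) mbar ((∑ c, z c) a) := by
    rw [coe_sum]
    exact Finset.sum_le_sum fun a _ => le_quad (hs.nonneg a) _ _ _
  refine le_of_eq_of_le ?_ (add_le_add (add_le_add hconj hindic) hquad)
  rw [← EReal.coe_add, ← EReal.coe_add, EReal.coe_eq_coe_iff, Finset.sum_sub_distrib,
    Finset.sum_sub_distrib, Finset.sum_sub_distrib, ← inner_sum, ← inner_sum, ← inner_sum,
    ← inner_diagonal, Fintype.sum_sum_type, inner_add_right, ← Finset.sum_mul, ← Finset.sum_mul,
    ← Finset.sum_div, hs.sum_eq, dualBound]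
  simp only [hr, EReal.toReal_coe]
  ring

theorem IsPrimalDualPair.exists_dualObj_eq [Nonempty V] (hE : StronglyConnected E)
    (hs : IsWeight s) (h : IsPrimalDualPair f mbar x z) :
    ∃ zAll : V ⊕ pairs E → ProdSpace E m, dualObj f mbar s zAll = dualBound f mbar x := by
  let w : ProdSpace E m := WithLp.toLp 2 (fun a => s a • (mbar - x)) -
    ∑ i, PiLp.single 2 (node i) (z i)
  have hw : ∑ a, w a = 0 := by
    simp only [w, PiLp.sub_apply, Finset.sum_sub_distrib, sum_sum_single, ← Finset.sum_smul,
      hs.sum_eq, h.sum_eq, sub_self]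
  obtain ⟨zF, hzF, hsumF⟩ := exists_hyper_orthogonal_sum_eq hE hw
  refine ⟨Sum.elim (fun i => PiLp.single 2 (node i) (z i)) zF, ?_⟩
  have hsum : ∑ c, Sum.elim (fun i => PiLp.single 2 (node i) (z i)) zF c =
      WithLp.toLp 2 (fun a => s a • (mbar - x)) := by
    simp only [Fintype.sum_sum_type, Sum.elim_inl, Sum.elim_inr, hsumF, w, add_sub_cancel]
  have hindic : ∑ b : pairs E, indic ((hyper m b.1)ᗮ : Set (ProdSpace E m)) (zF b) = 0 :=
    Finset.sum_eq_zero fun b _ => indic_of_mem (hzF b)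
  simp only [dualObj, Sum.elim_inl, Sum.elim_inr, hsum, conj_lift_single, hindic, add_zero,
    quad_smul_sub]
  rw [sum_conj_eq_of_isSubgrad h.isSubgrad, ← coe_sum, ← EReal.coe_add, EReal.coe_eq_coe_iff,
    h.sum_eq, ← Finset.sum_mul, ← Finset.sum_div, hs.sum_eq, real_inner_smul_right,
    inner_sub_right, real_inner_self_eq_norm_sq, real_inner_comm, dualBound]
  ring

theorem IsPrimalDualPair.dualValue_eq [Nonempty V] (hE : StronglyConnected E)
    (hs : IsWeight s) (h : IsPrimalDualPair f mbar x z) :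
    dualValue f mbar s = dualBound f mbar x := by
  obtain ⟨zAll, hzAll⟩ := h.exists_dualObj_eq hE hs
  refine le_antisymm (iInf_le_of_le zAll hzAll.le) (le_iInf fun zAll' =>
    dualBound_le_dualObj hs (fun i => ?_) zAll')
  obtain ⟨r, hr, -⟩ := h.isSubgrad i
  exact ⟨r, hr⟩

end Duality

section Loads

variable {X : Type*} [NormedAddCommGroup X] [InnerProductSpace ℝ X]

/-- The point `y / s` represented by a pair `(s, y)` of a weight and a vector; it is `0` if
`s = 0`. -/
noncomputable def center (p : ℝ × X) : X := p.1⁻¹ • p.2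

/-- The contribution `(s / 2) ‖y / s‖²` of a pair `(s, y)` to `Val`. -/
noncomputable def kinetic (p : ℝ × X) : ℝ := p.1 / 2 * ‖center p‖ ^ 2

theorem smul_center {p : ℝ × X} (hp : p.1 ≠ 0 ∨ p = 0) : p.1 • center p = p.2 := by
  rcases hp with hp | rfl
  · exact smul_inv_smul₀ hp p.2
  · exact zero_smul ℝ _

theorem center_smul {c : ℝ} (hc : c ≠ 0) (p : ℝ × X) : center (c • p) = center p := by
  rw [center, Prod.smul_fst, Prod.smul_snd, smul_eq_mul, mul_inv_rev, mul_smul,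
    inv_smul_smul₀ hc, center]

theorem kinetic_smul {c : ℝ} (hc : c ≠ 0) (p : ℝ × X) : kinetic (c • p) = c * kinetic p := by
  rw [kinetic, center_smul hc, kinetic, Prod.smul_fst, smul_eq_mul]
  ring

theorem kinetic_zero : kinetic (0 : ℝ × X) = 0 := by
  rw [kinetic, Prod.fst_zero, zero_div, zero_mul]

theorem kinetic_eq {p : ℝ × X} (hp : p.1 ≠ 0 ∨ p = 0) (x : X) :
    kinetic p = p.1 / 2 * ‖x‖ ^ 2 + inner ℝ x (p.2 - p.1 • x) +
      p.1 / 2 * ‖center p - x‖ ^ 2 := by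
  rw [kinetic, ← smul_center hp, ← smul_sub, real_inner_smul_right, norm_sub_sq_real,
    inner_sub_right, real_inner_self_eq_norm_sq, real_inner_comm]
  ring

theorem kinetic_eq_of_fst_eq {p q : ℝ × X} (hp : p.1 ≠ 0) (hpq : p.1 = q.1) :
    kinetic p = kinetic q + inner ℝ (center q) (p.2 - q.2) +
      p.1 / 2 * ‖center p - center q‖ ^ 2 := by
  rw [kinetic_eq (.inl hp) (center q), hpq, smul_center (.inl (hpq ▸ hp)), kinetic]

theorem kinetic_add_kinetic {p q : ℝ × X} (hp : p.1 ≠ 0 ∨ p = 0) (hq : q.1 ≠ 0 ∨ q = 0)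
    (hpq : (p + q).1 ≠ 0) :
    kinetic p + kinetic q = kinetic (p + q) + p.1 / 2 * ‖center p - center (p + q)‖ ^ 2 +
      q.1 / 2 * ‖center q - center (p + q)‖ ^ 2 := by
  have hbalance : p.2 - p.1 • center (p + q) + (q.2 - q.1 • center (p + q)) = 0 := by
    rw [sub_add_sub_comm, ← add_smul, ← Prod.fst_add, smul_center (.inl hpq), Prod.snd_add,
      sub_self]
  rw [kinetic_eq hp (center (p + q)), kinetic_eq hq (center (p + q)), kinetic,
    eq_neg_of_add_eq_zero_left hbalance, inner_neg_right, Prod.fst_add]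
  ring

theorem kinetic_add_le {p q : ℝ × X} (hp : 0 < p.1) (hq : 0 < q.1 ∨ q = 0) :
    kinetic (p + q) ≤ kinetic p + kinetic q := by
  have hq_nonneg : 0 ≤ q.1 := by
    rcases hq with hq | rfl
    exacts [hq.le, le_rfl]
  have hpq : (p + q).1 ≠ 0 := (add_pos_of_pos_of_nonneg hp hq_nonneg).ne'
  rw [kinetic_add_kinetic (.inl hp.ne') (hq.imp_left ne_of_gt) hpq, add_assoc]
  exact le_add_of_nonneg_right (by positivity)

end Loads

section Operations

variable {V : Type*} {E : Finset (V × V)} {m : ℕ}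

/-- The pair `(s_α, y_α)` of a node or an edge. -/
def State.load (S : State E m) (a : V ⊕ E) : ℝ × Vec m := (S.sAll (some a), S.yAll (some a))

theorem State.xAll_some (S : State E m) (a : V ⊕ E) : S.xAll (some a) = center (S.load a) := rfl

theorem sum_sub_sum_of_eq_off {ι M : Type*} [Fintype ι] [AddCommGroup M] {g g' : ι → M} (i : ι)
    (h : ∀ j, j ≠ i → g' j = g j) : ∑ j, g' j - ∑ j, g j = g' i - g i := by
  rw [← Finset.sum_sub_distrib, Fintype.sum_eq_single i fun j hj => sub_eq_zero.2 (h j hj)]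

variable [DecidableEq V]

/-- The state after operation `C` at node `j` with the new dual vector `z`. -/
def State.prox (S : State E m) (j : V) (z : Vec m) : State E m :=
  { S with
    z := Function.update S.z j z
    y := Function.update S.y j (S.y j + S.z j - z) }

theorem State.prox_eq (S : State E m) {j : V} (hs : S.s j ≠ 0) (z : Vec m) :
    { S with
      z := Function.update S.z j z
      y := Function.update S.y j (S.s j • S.xTemp j - z) } = S.prox j z := by
  rw [State.xTemp, smul_inv_smul₀ hs, State.prox]

theorem State.load_eq_smul_load_send (S : State E m) (i : V) :
    S.load (.inl i) = ((outdeg E i : ℝ) + 1) • (S.send i).load (.inl i) := by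
  have hd : (outdeg E i : ℝ) + 1 ≠ 0 := by positivity
  simp [State.load, State.send, State.sAll, State.yAll, mul_div_cancel₀ _ hd, smul_inv_smul₀ hd]

theorem State.load_send_of_ne (S : State E m) {i j : V} (h : j ≠ i) :
    (S.send i).load (.inl j) = S.load (.inl j) := by
  simp [State.load, State.send, State.sAll, State.yAll, h]

theorem State.load_send_edge_self (S : State E m) (e : E) :
    (S.send e.1.1).load (.inr e) = (S.send e.1.1).load (.inl e.1.1) + S.load (.inr e) := by
  simp only [State.load, State.send, State.sAll, State.yAll, Function.update_self, Prod.mk_add_mk,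
    Prod.mk.injEq]
  constructor <;> abel

theorem State.load_send_edge_of_ne (S : State E m) {i : V} {e : E} (h : e.1.1 ≠ i) :
    (S.send i).load (.inr e) = S.load (.inr e) := by
  simp [State.load, State.send, State.sAll, State.yAll, h]

theorem State.load_receive_self (S : State E m) (e : E) :
    (S.receive e).load (.inl e.1.2) = S.load (.inl e.1.2) + S.load (.inr e) := by
  simp [State.load, State.receive, State.sAll, State.yAll, add_sub_assoc]

theorem State.load_receive_of_ne (S : State E m) {e : E} {j : V} (h : j ≠ e.1.2) :
    (S.receive e).load (.inl j) = S.load (.inl j) := by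
  simp [State.load, State.receive, State.sAll, State.yAll, h]

theorem State.load_receive_edge_self (S : State E m) (e : E) :
    (S.receive e).load (.inr e) = 0 := by
  simp [State.load, State.receive, State.sAll, State.yAll]

theorem State.load_receive_edge_of_ne (S : State E m) {e e' : E} (h : e' ≠ e) :
    (S.receive e).load (.inr e') = S.load (.inr e') := by
  simp [State.load, State.receive, State.sAll, State.yAll, h]

theorem State.load_prox_self (S : State E m) (j : V) (z : Vec m) :
    (S.prox j z).load (.inl j) = (S.s j, S.y j + S.z j - z) := by
  simp [State.load, State.prox, State.sAll, State.yAll]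

theorem State.load_prox_of_ne (S : State E m) {j : V} (z : Vec m) {a : V ⊕ E} (h : a ≠ .inl j) :
    (S.prox j z).load a = S.load a := by
  rcases a with i | e
  · have hij : i ≠ j := fun hij => h (hij ▸ rfl)
    simp [State.load, State.prox, State.sAll, State.yAll, hij]
  · rfl

theorem card_filter_fst (i : V) :
    (Finset.univ.filter fun e : E => e.1.1 = i).card = outdeg E i := by
  rw [outdeg, Finset.card_filter, Finset.card_filter,
    Finset.sum_coe_sort E fun e => if e.1 = i then 1 else 0]

variable [Fintype V] {M : Type*} [AddCommGroup M] (G : ℝ × Vec m → M)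

theorem State.sum_load_send (S : State E m) (i : V) :
    ∑ a, G ((S.send i).load a) - ∑ a, G (S.load a) =
      G ((S.send i).load (.inl i)) - G (S.load (.inl i)) +
        ∑ e : E with e.1.1 = i,
          (G ((S.send i).load (.inl i) + S.load (.inr e)) - G (S.load (.inr e))) := by
  rw [Fintype.sum_sum_type, Fintype.sum_sum_type, add_sub_add_comm,
    sum_sub_sum_of_eq_off i fun j hj => congrArg G (S.load_send_of_ne hj),
    ← Finset.sum_sub_distrib, Finset.sum_filter]
  congr 1
  refine Finset.sum_congr rfl fun e _ => ?_
  split_ifs with he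
  · subst he
    rw [S.load_send_edge_self]
  · rw [S.load_send_edge_of_ne he, sub_self]

theorem State.sum_load_receive (S : State E m) (e : E) :
    ∑ a, G ((S.receive e).load a) - ∑ a, G (S.load a) =
      G (S.load (.inl e.1.2) + S.load (.inr e)) - G (S.load (.inl e.1.2)) +
        (G 0 - G (S.load (.inr e))) := by
  rw [Fintype.sum_sum_type, Fintype.sum_sum_type, add_sub_add_comm,
    sum_sub_sum_of_eq_off e.1.2 fun j hj => congrArg G (S.load_receive_of_ne hj),
    sum_sub_sum_of_eq_off e fun e' he => congrArg G (S.load_receive_edge_of_ne he),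
    S.load_receive_self, S.load_receive_edge_self]

theorem State.sum_load_prox (S : State E m) (j : V) (z : Vec m) :
    ∑ a, G ((S.prox j z).load a) - ∑ a, G (S.load a) =
      G (S.s j, S.y j + S.z j - z) - G (S.load (.inl j)) := by
  rw [sum_sub_sum_of_eq_off (.inl j) fun a ha => congrArg G (S.load_prox_of_ne z ha),
    S.load_prox_self]

end Operations

section Invariant

variable {V : Type*} [Fintype V] {E : Finset (V × V)} {m : ℕ} {mbar : Vec m} {ε : ℝ}
  {S : State E m}

/-- The invariant of the algorithm: edges carry either nothing or a weight of at least `ε`, and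
the operations only redistribute the weights and the sum `∑ y_α + ∑ z_i`. -/
structure State.Inv (mbar : Vec m) (ε : ℝ) (S : State E m) : Prop where
  le_node : ∀ i, ε ≤ S.s i
  edge : ∀ e : E, S.load (.inr e) = 0 ∨ ε ≤ (S.load (.inr e)).1
  sum_load : ∑ a, S.load a = ((Fintype.card V : ℝ), (Fintype.card V : ℝ) • mbar - ∑ i, S.z i)

theorem State.IsInitial.inv (h : S.IsInitial mbar) (hs : ∀ i, ε ≤ S.s i) : S.Inv mbar ε where
  le_node := hs
  edge e := .inl <| by
    simp [State.load, State.sAll, State.yAll, h.sigS_eq, h.rhoS_eq, h.sigY_eq, h.rhoY_eq]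
  sum_load := by
    ext1 <;> simp [State.load, State.sAll, State.yAll, Prod.fst_sum, Prod.snd_sum, h.sigS_eq,
      h.rhoS_eq, h.sigY_eq, h.rhoY_eq, h.s_eq, h.z_eq, h.y_sum]

namespace State.Inv

theorem load (h : S.Inv mbar ε) (a : V ⊕ E) : S.load a = 0 ∨ ε ≤ (S.load a).1 := by
  rcases a with i | e
  exacts [.inr (h.le_node i), h.edge e]

theorem pos_or_eq_zero (h : S.Inv mbar ε) (hε : 0 < ε) (a : V ⊕ E) :
    0 < (S.load a).1 ∨ S.load a = 0 :=
  (h.load a).symm.imp_left hε.trans_le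

theorem ne_zero_or_eq_zero (h : S.Inv mbar ε) (hε : 0 < ε) (a : V ⊕ E) :
    (S.load a).1 ≠ 0 ∨ S.load a = 0 :=
  (h.pos_or_eq_zero hε a).imp_left ne_of_gt

theorem weight_nonneg (h : S.Inv mbar ε) (hε : 0 < ε) (a : V ⊕ E) : 0 ≤ (S.load a).1 := by
  rcases h.pos_or_eq_zero hε a with ha | ha
  exacts [ha.le, ha ▸ le_rfl]

theorem sum_weight (h : S.Inv mbar ε) : ∑ a, (S.load a).1 = Fintype.card V := by
  rw [← Prod.fst_sum, h.sum_load]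

theorem sum_vector (h : S.Inv mbar ε) :
    ∑ a, (S.load a).2 = (Fintype.card V : ℝ) • mbar - ∑ i, S.z i := by
  rw [← Prod.snd_sum, h.sum_load]

theorem weight_le_card (h : S.Inv mbar ε) (hε : 0 < ε) (a : V ⊕ E) :
    (S.load a).1 ≤ Fintype.card V := by
  rw [← h.sum_weight]
  exact Finset.single_le_sum (fun a _ => h.weight_nonneg hε a) (Finset.mem_univ a)

theorem norm_weight_smul_le (h : S.Inv mbar ε) (hε : 0 < ε) (a : V ⊕ E) (v : Vec m) :
    ‖(S.load a).1 • v‖ ≤ Fintype.card V * ‖v‖ := by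
  rw [norm_smul, Real.norm_of_nonneg (h.weight_nonneg hε a)]
  exact mul_le_mul_of_nonneg_right (h.weight_le_card hε a) (norm_nonneg v)

theorem weight_mul_sq_norm_le (h : S.Inv mbar ε) (hε : 0 < ε) (a : V ⊕ E) (v : Vec m) :
    (S.load a).1 / 2 * ‖v‖ ^ 2 ≤ ‖(S.load a).1 • v‖ ^ 2 / (2 * ε) := by
  rw [norm_smul, mul_pow, Real.norm_eq_abs, sq_abs]
  rcases h.load a with h0 | hle
  · simp only [h0, Prod.fst_zero, zero_div, zero_mul, ne_eq, OfNat.ofNat_ne_zero,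
      not_false_eq_true, zero_pow, le_refl]
  · rw [le_div_iff₀ (mul_pos two_pos hε)]
    calc (S.load a).1 / 2 * ‖v‖ ^ 2 * (2 * ε) = (S.load a).1 * ‖v‖ ^ 2 * ε := by ring
      _ ≤ (S.load a).1 * ‖v‖ ^ 2 * (S.load a).1 :=
        mul_le_mul_of_nonneg_left hle (mul_nonneg (h.weight_nonneg hε a) (sq_nonneg _))
      _ = (S.load a).1 ^ 2 * ‖v‖ ^ 2 := by ring

theorem sum_smul_center_sub (h : S.Inv mbar ε) (hε : 0 < ε) (x : Vec m) :
    ∑ a, (S.load a).1 • (center (S.load a) - x) =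
      (Fintype.card V : ℝ) • (mbar - x) - ∑ i, S.z i := by
  simp only [smul_sub, smul_center (h.ne_zero_or_eq_zero hε _), Finset.sum_sub_distrib,
    ← Finset.sum_smul, h.sum_weight, h.sum_vector]
  abel

variable [DecidableEq V]

theorem send (h : S.Inv mbar ε) (hε : 0 < ε) {i : V} (hs : ∀ j, ε ≤ (S.send i).s j) :
    (S.send i).Inv mbar ε where
  le_node := hs
  edge e := by
    by_cases he : e.1.1 = i
    · subst he
      rw [S.load_send_edge_self]
      exact .inr (le_add_of_le_of_nonneg (hs _) (h.weight_nonneg hε _))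
    · rw [S.load_send_edge_of_ne he]
      exact h.edge e
  sum_load := by
    refine (sub_eq_zero.1 ((S.sum_load_send id i).trans ?_)).trans h.sum_load
    simp only [id_eq, add_sub_cancel_right, Finset.sum_const, card_filter_fst]
    rw [← Nat.cast_smul_eq_nsmul ℝ, S.load_eq_smul_load_send, add_smul, one_smul]
    abel

theorem receive (h : S.Inv mbar ε) {e : E} (hs : ∀ j, ε ≤ (S.receive e).s j) :
    (S.receive e).Inv mbar ε where
  le_node := hs
  edge e' := by
    by_cases he : e' = e
    · exact .inl (he ▸ S.load_receive_edge_self e)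
    · rw [S.load_receive_edge_of_ne he]
      exact h.edge e'
  sum_load := by
    refine (sub_eq_zero.1 ((S.sum_load_receive id e).trans ?_)).trans h.sum_load
    simp

theorem prox (h : S.Inv mbar ε) (j : V) (z : Vec m) : (S.prox j z).Inv mbar ε where
  le_node := h.le_node
  edge := h.edge
  sum_load := by
    have hz : ∑ i, (S.prox j z).z i - ∑ i, S.z i = z - S.z j := by
      rw [sum_sub_sum_of_eq_off j fun i hi => by simp [State.prox, hi]]
      simp [State.prox]
    have hload : ∑ a, (S.prox j z).load a - ∑ a, S.load a = (0, S.z j - z) := by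
      refine (S.sum_load_prox id j z).trans ?_
      simp [State.load, State.sAll, State.yAll, add_sub_assoc]
    rw [sub_eq_iff_eq_add.1 hload, h.sum_load, sub_eq_iff_eq_add.1 hz]
    ext1
    · simp
    · simp only [Prod.mk_add_mk]
      abel

end State.Inv

end Invariant

section Updates

variable {V : Type*} [DecidableEq V] {E : Finset (V × V)} {m : ℕ} {f : V → Vec m → EReal}
  {S : State E m}

theorem State.xAll_send (S : State E m) (i j : V) :
    (S.send i).xAll (node j) = S.xAll (node j) := by
  rw [State.xAll_some, State.xAll_some]
  by_cases hij : j = i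
  · rw [hij, S.load_eq_smul_load_send, center_smul (by positivity)]
  · rw [S.load_send_of_ne hij]

theorem State.isSubgrad_prox {j : V} (hf : IsClosedProperConvex (f j)) (hs : 0 < S.s j) {z : Vec m}
    (hz : IsMinOn (S.proxObj f j) Set.univ z) :
    IsSubgrad (f j) ((S.prox j z).xAll (node j)) z := by
  have hcenter : (S.prox j z).xAll (node j) = S.xTemp j - (S.s j)⁻¹ • z := by
    rw [State.xAll_some, S.load_prox_self, center, State.xTemp, smul_sub]
  rw [hcenter]
  exact hf.isSubgrad_of_conj ((isClosedProperConvex_conj hf).isSubgrad_of_isMinOn_quad_add hs hz)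

end Updates

section Values

variable {V : Type*} [Fintype V] {E : Finset (V × V)} {m : ℕ} {f : V → Vec m → EReal}
  {mbar : Vec m} {ε : ℝ} {S S' : State E m}

/-- The value `∑ f_i^*(z_i) + ∑ (s_α / 2) ‖x_α‖²` as a real number; it is meaningful if the
conjugates are finite. -/
noncomputable def State.realVal (f : V → Vec m → EReal) (S : State E m) : ℝ :=
  ∑ i, (conj (f i) (S.z i)).toReal + ∑ a, kinetic (S.load a)

theorem State.Inv.realVal_eq (h : S.Inv mbar ε) (hε : 0 < ε) (f : V → Vec m → EReal)
    (x : Vec m) :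
    S.realVal f = dualBound f mbar x +
      ∑ i, ((conj (f i) (S.z i)).toReal + (f i x).toReal - inner ℝ x (S.z i)) +
      ∑ a, (S.load a).1 / 2 * ‖center (S.load a) - x‖ ^ 2 := by
  have hmoment : ∑ a, ((S.load a).2 - (S.load a).1 • x) =
      (Fintype.card V : ℝ) • (mbar - x) - ∑ i, S.z i := by
    rw [Finset.sum_sub_distrib, ← Finset.sum_smul, h.sum_weight, h.sum_vector, smul_sub]
    abel
  simp only [State.realVal, kinetic_eq (h.ne_zero_or_eq_zero hε _) x, Finset.sum_add_distrib,
    Finset.sum_sub_distrib, ← inner_sum, hmoment, ← Finset.sum_mul, ← Finset.sum_div, h.sum_weight,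
    dualBound]
  rw [inner_sub_right, real_inner_smul_right, inner_sub_right, real_inner_self_eq_norm_sq,
    real_inner_comm x mbar]
  ring

theorem State.Inv.kinetic_nonneg (h : S.Inv mbar ε) (hε : 0 < ε) (a : V ⊕ E) :
    0 ≤ kinetic (S.load a) :=
  mul_nonneg (div_nonneg (h.weight_nonneg hε a) zero_le_two) (sq_nonneg _)

theorem State.Inv.sq_norm_sub_le (h : S.Inv mbar ε) (hε : 0 < ε) {x : Vec m}
    (hx : ∀ i, ∃ r : ℝ, f i x = r) (hfin : ∀ i, conj (f i) (S.z i) ≠ ⊤) (i : V) :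
    ε / 2 * ‖S.xAll (node i) - x‖ ^ 2 ≤ S.realVal f - dualBound f mbar x := by
  have hgap : 0 ≤ ∑ i, ((conj (f i) (S.z i)).toReal + (f i x).toReal - inner ℝ x (S.z i)) := by
    refine Finset.sum_nonneg fun i _ => ?_
    obtain ⟨r, hr⟩ := hx i
    rw [hr, EReal.toReal_coe]
    linarith [inner_sub_le_toReal_conj hr (hfin i)]
  have hnode : ε / 2 * ‖S.xAll (node i) - x‖ ^ 2 ≤
      ∑ a, (S.load a).1 / 2 * ‖center (S.load a) - x‖ ^ 2 := by
    refine le_trans ?_ (Finset.single_le_sum (fun a _ => mul_nonneg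
      (div_nonneg (h.weight_nonneg hε a) zero_le_two) (sq_nonneg _)) (Finset.mem_univ (.inl i)))
    exact mul_le_mul_of_nonneg_right (div_le_div_of_nonneg_right (h.le_node i) zero_le_two)
      (sq_nonneg _)
  linarith [h.realVal_eq hε f x]

/-- The quantity `s_e (x_e - x_i)` of an edge `e = (i, j)`, which measures by how much the data
under way on `e` differ from those of the sender. -/
noncomputable def State.lag (S : State E m) (e : E) : Vec m :=
  S.yAll (edge e) - S.sAll (edge e) • S.xAll (node e.1.1)

theorem State.Inv.lag_eq (h : S.Inv mbar ε) (hε : 0 < ε) (e : E) :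
    S.lag e = S.sAll (DualAscent.edge e) •
      (S.xAll (DualAscent.edge e) - S.xAll (node e.1.1)) := by
  have hy := smul_center (h.ne_zero_or_eq_zero hε (.inr e))
  rw [State.lag, smul_sub, State.xAll_some]
  exact congrArg (· - _) hy.symm

variable [DecidableEq V]

theorem State.Inv.realVal_send_le (h : S.Inv mbar ε) (hε : 0 < ε) {i : V}
    (hs : 0 < (S.send i).s i) : (S.send i).realVal f ≤ S.realVal f := by
  have hd : (outdeg E i : ℝ) + 1 ≠ 0 := by positivity
  have hsum := S.sum_load_send kinetic i
  have hmerge : ∑ e : E with e.1.1 = i,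
      (kinetic ((S.send i).load (.inl i) + S.load (.inr e)) - kinetic (S.load (.inr e))) ≤
        outdeg E i * kinetic ((S.send i).load (.inl i)) := by
    rw [← card_filter_fst, ← nsmul_eq_mul]
    exact Finset.sum_le_card_nsmul _ _ _ fun e _ =>
      sub_le_iff_le_add.2 (kinetic_add_le hs (h.pos_or_eq_zero hε _))
  rw [S.load_eq_smul_load_send, kinetic_smul hd] at hsum
  refine add_le_add_right ?_ _
  linarith

theorem State.realVal_receive (h : S.Inv mbar ε) (hε : 0 < ε) (f : V → Vec m → EReal) (e : E)
    (hs : 0 < (S.receive e).s e.1.2) :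
    S.realVal f = (S.receive e).realVal f +
      S.s e.1.2 / 2 * ‖S.xAll (node e.1.2) - (S.receive e).xAll (node e.1.2)‖ ^ 2 +
      S.sAll (edge e) / 2 * ‖S.xAll (edge e) - (S.receive e).xAll (node e.1.2)‖ ^ 2 := by
  have hsum := S.sum_load_receive kinetic e
  have hload := S.load_receive_self e
  have hmerge := kinetic_add_kinetic (h.ne_zero_or_eq_zero hε (.inl e.1.2))
    (h.ne_zero_or_eq_zero hε (.inr e)) (hload ▸ hs.ne')
  rw [kinetic_zero] at hsum
  rw [← hload] at hsum hmerge
  simp only [State.xAll_some, State.realVal]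
  change _ = ∑ i, (conj (f i) (S.z i)).toReal + _ + (S.load (.inl e.1.2)).1 / 2 * _ +
    (S.load (.inr e)).1 / 2 * _
  linarith

theorem State.realVal_prox_le {j : V} (hs : 0 < S.s j)
    (hfin : conj (f j) (S.z j) ≠ ⊤) {z : Vec m}
    (hsub : IsSubgrad (f j) ((S.prox j z).xAll (node j)) z) :
    (S.prox j z).realVal f +
      S.s j / 2 * ‖S.xAll (node j) - (S.prox j z).xAll (node j)‖ ^ 2 ≤ S.realVal f := by
  have hsum := S.sum_load_prox kinetic j z
  have hself := S.load_prox_self j z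
  have hkinetic := kinetic_eq_of_fst_eq (p := S.load (.inl j)) (q := (S.prox j z).load (.inl j))
    hs.ne' rfl
  have hvector : (S.load (.inl j)).2 - ((S.prox j z).load (.inl j)).2 = z - S.z j := by
    rw [hself]
    change S.y j - (S.y j + S.z j - z) = _
    abel
  rw [← hself] at hsum
  rw [hvector, inner_sub_right] at hkinetic
  obtain ⟨r, hr, -⟩ := id hsub
  have hconj_old : inner ℝ ((S.prox j z).xAll (node j)) (S.z j) - r ≤
      (conj (f j) (S.z j)).toReal := inner_sub_le_toReal_conj hr hfin
  have hconj_new : (conj (f j) z).toReal = inner ℝ ((S.prox j z).xAll (node j)) z - r := by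
    rw [hsub.conj_eq hr, EReal.toReal_coe]
  have hconj : ∑ i, (conj (f i) ((S.prox j z).z i)).toReal - ∑ i, (conj (f i) (S.z i)).toReal =
      (conj (f j) z).toReal - (conj (f j) (S.z j)).toReal := by
    rw [sum_sub_sum_of_eq_off j fun i hi => by simp [State.prox, hi]]
    simp [State.prox]
  change kinetic (S.load (.inl j)) = _ + _ + S.s j / 2 * _ at hkinetic
  simp only [State.realVal, State.xAll_some] at hconj_old hconj_new ⊢
  linarith

end Values

section Compatible

variable {V : Type*} [Fintype V] [DecidableEq V] {E : Finset (V × V)} {m : ℕ}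
  {f : V → Vec m → EReal} {mbar : Vec m} {ε : ℝ} {S : State E m} {zF : pairs E → ProdSpace E m}

theorem Val_eq_sum_conj_add (h : Compatible mbar S zF) :
    Val f (S.tuple zF) = ∑ i, conj (f i) (S.z i) + ((∑ a, kinetic (S.load a) : ℝ) : EReal) := by
  have hindic : ∑ b, indic ((hyper m b.1)ᗮ : Set (ProdSpace E m)) ((S.tuple zF).z (.inr b)) = 0 :=
    Finset.sum_eq_zero fun b _ => indic_of_mem (h.mem_orthogonal b)
  rw [Val, hindic, add_zero, coe_sum]
  exact congrArg (· + _) (Finset.sum_congr rfl fun i _ => conj_lift_single f i (S.z i))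

theorem Val_eq_realVal (hf : ∀ i, IsClosedProperConvex (f i)) (h : Compatible mbar S zF)
    (hfin : ∀ i, conj (f i) (S.z i) ≠ ⊤) : Val f (S.tuple zF) = S.realVal f := by
  rw [Val_eq_sum_conj_add h, State.realVal, EReal.coe_add, coe_sum _ fun i => EReal.toReal _]
  simp only [EReal.coe_toReal (hfin _) ((isClosedProperConvex_conj (hf _)).ne_bot _)]

theorem Val_eq_top (hf : ∀ i, IsClosedProperConvex (f i)) (h : Compatible mbar S zF) {i : V}
    (hi : conj (f i) (S.z i) = ⊤) : Val f (S.tuple zF) = ⊤ := by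
  have hne_bot : ∑ j ∈ Finset.univ.erase i, conj (f j) (S.z j) ≠ ⊥ :=
    Finset.sum_induction _ (· ≠ ⊥)
      (fun _ _ ha hb hab => (EReal.add_eq_bot_iff.1 hab).elim ha hb) EReal.zero_ne_bot
      fun j _ => (isClosedProperConvex_conj (hf j)).ne_bot _
  rw [Val_eq_sum_conj_add h, ← Finset.add_sum_erase _ _ (Finset.mem_univ i), hi,
    EReal.top_add_of_ne_bot hne_bot, EReal.top_add_coe]

theorem State.Inv.exists_compatible [Nonempty V] (hE : StronglyConnected E) (h : S.Inv mbar ε) :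
    ∃ zF : pairs E → ProdSpace E m, Compatible mbar S zF ∧
      ∀ b : pairs E, none ∈ b.1 → zF b = 0 := by
  let target : ProdSpace E m := WithLp.toLp 2 fun a => S.sAll a • mbar - S.yAll a
  let single : ProdSpace E m := ∑ i, PiLp.single 2 (node i) (S.z i)
  have htarget : ∑ a, target a = ∑ i, S.z i := by
    have hs : ∑ a, S.sAll a = Fintype.card V := by
      rw [Fintype.sum_option, ← h.sum_weight]
      exact zero_add _
    have hy : ∑ a, S.yAll a = (Fintype.card V : ℝ) • mbar - ∑ i, S.z i := by
      rw [Fintype.sum_option, ← h.sum_vector]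
      exact zero_add _
    rw [Finset.sum_sub_distrib, ← Finset.sum_smul, hs, hy, sub_sub_cancel]
  have hsum : ∑ a, (target - single) a = 0 := by
    simp only [PiLp.sub_apply, Finset.sum_sub_distrib, htarget, single, sum_sum_single, sub_self]
  have hnone : (target - single) none = 0 := by
    simp [target, single, State.sAll, State.yAll]
  obtain ⟨zF, horth, hzF, hzero⟩ := exists_hyper_orthogonal_sum_eq_of_none hE hsum hnone
  refine ⟨zF, ⟨horth, fun a ha => ?_⟩, hzero⟩
  have hz : ∑ c, (S.tuple zF).z c = target := by
    rw [Fintype.sum_sum_type]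
    exact (congrArg (single + ·) hzF).trans (add_sub_cancel single target)
  rw [hz]
  change mbar - (S.sAll a)⁻¹ • (S.sAll a • mbar - S.yAll a) = _
  rw [smul_sub, inv_smul_smul₀ ha.ne', sub_sub_cancel, State.xAll]

end Compatible

section Steps

variable {V : Type*} [DecidableEq V] {E : Finset (V × V)} {m : ℕ}
  {f : V → Vec m → EReal} {mbar : Vec m} {ε : ℝ} {S S' : State E m} {o : Op E}

theorem Step.exists_eq_prox {j : V} (hstep : Step f (.C j) S S') (hs : S.s j ≠ 0) :
    ∃ z, IsMinOn (S.proxObj f j) Set.univ z ∧ S' = S.prox j z := by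
  obtain ⟨z, hz, rfl⟩ := hstep
  exact ⟨z, hz, S.prox_eq hs z⟩

theorem Step.z_eq {i : V} (hstep : Step f o S S') (ho : o ≠ .C i) : S'.z i = S.z i := by
  rcases o with j | e | j
  · obtain rfl := hstep
    rfl
  · obtain rfl := hstep
    rfl
  · obtain ⟨z, -, rfl⟩ := hstep
    exact Function.update_of_ne (fun hij => ho (congrArg Op.C hij.symm)) _ _

theorem Step.isSubgrad {j : V} (hf : IsClosedProperConvex (f j)) (hs : 0 < S.s j)
    (hstep : Step f (.C j) S S') : IsSubgrad (f j) (S'.xAll (node j)) (S'.z j) := by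
  obtain ⟨z, hz, rfl⟩ := hstep.exists_eq_prox hs.ne'
  have hz' : (S.prox j z).z j = z := Function.update_self ..
  rw [hz']
  exact State.isSubgrad_prox hf hs hz

theorem Step.conj_ne_top {i : V} (hf : IsClosedProperConvex (f i)) (hs : 0 < S.s i)
    (hstep : Step f o S S') (hi : conj (f i) (S.z i) ≠ ⊤) : conj (f i) (S'.z i) ≠ ⊤ := by
  by_cases ho : o = .C i
  · subst ho
    exact (hstep.isSubgrad hf hs).conj_ne_top
  · rwa [hstep.z_eq ho]

theorem Step.load_edge_eq {e : E} (hstep : Step f o S S') (hA : o ≠ .A e.1.1) (hB : o ≠ .B e) :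
    S'.load (.inr e) = S.load (.inr e) := by
  rcases o with i | e' | j
  · obtain rfl := hstep
    exact S.load_send_edge_of_ne fun hi => hA (congrArg Op.A hi.symm)
  · obtain rfl := hstep
    exact S.load_receive_edge_of_ne fun he => hB (congrArg Op.B he.symm)
  · obtain ⟨z, -, rfl⟩ := hstep
    rfl

theorem Step.weight_edge_le {e : E} (hstep : Step f o S S') (hs : 0 ≤ S'.s e.1.1)
    (ho : o ≠ .B e) : S.sAll (edge e) ≤ S'.sAll (edge e) := by
  by_cases hA : o = .A e.1.1
  · subst hA
    obtain rfl := hstep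
    exact (le_add_of_nonneg_left hs).trans_eq (congrArg Prod.fst (S.load_send_edge_self e)).symm
  · exact (congrArg Prod.fst (hstep.load_edge_eq hA ho)).ge

theorem Step.lag_eq_zero {e : E} (hstep : Step f (.B e) S S') : S'.lag e = 0 := by
  obtain rfl := hstep
  have hload := S.load_receive_edge_self e
  rw [State.load, Prod.mk_eq_zero] at hload
  rw [State.lag, hload.1, hload.2, zero_smul, sub_zero]

theorem Step.lag_eq_sub {e : E} (hstep : Step f o S S') (hs : S'.s e.1.1 ≠ 0) (ho : o ≠ .B e) :
    S'.lag e = S.lag e -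
      S.sAll (edge e) • (S'.xAll (node e.1.1) - S.xAll (node e.1.1)) := by
  by_cases hA : o = .A e.1.1
  · subst hA
    obtain rfl := hstep
    have hnode : (S.send e.1.1).s e.1.1 • S.xAll (node e.1.1) = (S.send e.1.1).y e.1.1 := by
      rw [← S.xAll_send e.1.1]
      exact smul_center (p := (S.send e.1.1).load (.inl e.1.1)) (.inl hs)
    have hload : (_, _) = (_, _) := S.load_send_edge_self e
    rw [Prod.mk.injEq] at hload
    rw [State.lag, State.lag, S.xAll_send, sub_self, smul_zero, sub_zero, hload.1, hload.2]
    change _ + _ - ((S.send e.1.1).s e.1.1 + _) • _ = _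
    rw [add_smul, hnode]
    exact add_sub_add_left_eq_sub _ _ _
  · have hload : (_, _) = (_, _) := hstep.load_edge_eq hA ho
    rw [Prod.mk.injEq] at hload
    rw [State.lag, State.lag, hload.1, hload.2, smul_sub]
    abel

variable [Fintype V]

theorem Step.le_weight_edge {e : E} (hstep : Step f (.A e.1.1) S S') (h : S.Inv mbar ε)
    (hε : 0 < ε) (hs : ε ≤ S'.s e.1.1) : ε ≤ S'.sAll (edge e) := by
  obtain rfl := hstep
  exact (le_add_of_le_of_nonneg hs (h.weight_nonneg hε (.inr e))).trans_eq
    (congrArg Prod.fst (S.load_send_edge_self e)).symm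

theorem Step.inv (h : S.Inv mbar ε) (hε : 0 < ε) (hstep : Step f o S S') (hs : ∀ i, ε ≤ S'.s i) :
    S'.Inv mbar ε := by
  rcases o with i | e | j
  · obtain rfl := hstep
    exact h.send hε hs
  · obtain rfl := hstep
    exact h.receive hs
  · obtain ⟨z, -, rfl⟩ := hstep.exists_eq_prox (hε.trans_le (h.le_node j)).ne'
    exact h.prox j z

theorem Step.realVal_add_le (hf : ∀ i, IsClosedProperConvex (f i)) (h : S.Inv mbar ε)
    (hε : 0 < ε) (hstep : Step f o S S') (hs : ∀ i, ε ≤ S'.s i)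
    (hfin : ∀ i, conj (f i) (S.z i) ≠ ⊤) (i : V) :
    S'.realVal f + ε / 2 * ‖S'.xAll (node i) - S.xAll (node i)‖ ^ 2 ≤ S.realVal f := by
  have hle (j : V) (x : Vec m) : ε / 2 * ‖x - S.xAll (node j)‖ ^ 2 ≤
      S.s j / 2 * ‖S.xAll (node j) - x‖ ^ 2 := by
    rw [norm_sub_rev]
    gcongr
    exact h.le_node j
  have hfixed (hx : S'.xAll (node i) = S.xAll (node i)) (hval : S'.realVal f ≤ S.realVal f) :
      S'.realVal f + ε / 2 * ‖S'.xAll (node i) - S.xAll (node i)‖ ^ 2 ≤ S.realVal f := by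
    rwa [hx, sub_self, norm_zero, zero_pow two_ne_zero, mul_zero, add_zero]
  rcases o with j | e | j
  · obtain rfl := hstep
    exact hfixed (S.xAll_send j i) (h.realVal_send_le hε (hε.trans_le (hs j)))
  · obtain rfl := hstep
    have hval := State.realVal_receive h hε f e (hε.trans_le (hs _))
    have hnode := hle e.1.2 ((S.receive e).xAll (node e.1.2))
    have hnonneg : 0 ≤ S.sAll (DualAscent.edge e) / 2 *
        ‖S.xAll (DualAscent.edge e) - (S.receive e).xAll (node e.1.2)‖ ^ 2 :=
      mul_nonneg (div_nonneg (h.weight_nonneg hε (.inr e)) zero_le_two) (sq_nonneg _)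
    have hnode_nonneg := (by positivity : 0 ≤ ε / 2 * _ ^ 2).trans hnode
    by_cases hi : i = e.1.2
    · subst hi
      linarith
    · exact hfixed (congrArg center (S.load_receive_of_ne hi)) (by linarith)
  · have hsj := hε.trans_le (h.le_node j)
    obtain ⟨z, hz, rfl⟩ := hstep.exists_eq_prox hsj.ne'
    have hval := State.realVal_prox_le hsj (hfin j) (State.isSubgrad_prox (hf j) hsj hz)
    have hnode := hle j ((S.prox j z).xAll (node j))
    have hnode_nonneg := (by positivity : 0 ≤ ε / 2 * _ ^ 2).trans hnode
    by_cases hij : i = j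
    · subst hij
      linarith
    · exact hfixed (congrArg center (S.load_prox_of_ne z fun hinl => hij (Sum.inl.inj hinl)))
        (by linarith)

theorem Step.sq_norm_sub_le_of_receive (h : S.Inv mbar ε) (hε : 0 < ε) {e : E}
    (hstep : Step f (.B e) S S') (hs : ε ≤ S'.s e.1.2) (he : ε ≤ S.sAll (edge e)) :
    ε / 2 * ‖S.xAll (node e.1.2) - S'.xAll (node e.1.2)‖ ^ 2 ≤ S.realVal f - S'.realVal f ∧
      ε / 2 * ‖S.xAll (edge e) - S'.xAll (node e.1.2)‖ ^ 2 ≤ S.realVal f - S'.realVal f := by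
  obtain rfl := hstep
  rw [State.realVal_receive h hε f e (hε.trans_le hs), add_assoc, add_sub_cancel_left]
  have hnode : ε ≤ S.s e.1.2 := h.le_node e.1.2
  constructor
  · refine le_add_of_le_of_nonneg (by gcongr) (mul_nonneg ?_ (sq_nonneg _))
    linarith
  · refine le_add_of_nonneg_of_le (mul_nonneg ?_ (sq_nonneg _)) (by gcongr)
    linarith

end Steps

section Runs

variable {V : Type*} [Fintype V] [DecidableEq V] {E : Finset (V × V)} {m K : ℕ} {M ε : ℝ}
  {f : V → Vec m → EReal} {mbar : Vec m} {op : ℕ → Op E} {S : ℕ → State E m}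

/-- A run of the algorithm whose node weights stay above the positive number `ε`. -/
structure IsNondegenerateRun (f : V → Vec m → EReal) (mbar : Vec m) (ε : ℝ) (op : ℕ → Op E)
    (S : ℕ → State E m) : Prop extends IsRun f mbar op S where
  pos : 0 < ε
  le_s : ∀ k i, ε ≤ (S k).s i

/-- A nondegenerate run with bounded dual vectors `z_i` that performs every operation at least once
in any `K` consecutive iterations. -/
structure IsFairRun (f : V → Vec m → EReal) (mbar : Vec m) (ε M : ℝ) (K : ℕ) (op : ℕ → Op E)
    (S : ℕ → State E m) : Prop extends IsNondegenerateRun f mbar ε op S where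
  norm_z_le : ∀ k i, ‖(S k).z i‖ ≤ M
  recurs : ∀ o, Recurs op K o

open Classical in
/-- The value of `x_i` right after the latest operation `C` at node `i`; it is the point at which
the current `z_i` is a subgradient of `f_i`. Before the first such operation it is `0`. -/
noncomputable def lastProx (op : ℕ → Op E) (S : ℕ → State E m) (i : V) : ℕ → Vec m
  | 0 => 0
  | k + 1 => if op k = .C i then (S (k + 1)).xAll (node i) else lastProx op S i k

namespace IsNondegenerateRun

theorem inv (h : IsNondegenerateRun f mbar ε op S) (k : ℕ) : (S k).Inv mbar ε := by
  induction k with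
  | zero => exact h.init.inv (h.le_s 0)
  | succ k ih => exact (h.step k).inv ih h.pos (h.le_s (k + 1))

theorem step_of_eq (h : IsNondegenerateRun f mbar ε op S) {k : ℕ} {o : Op E} (ho : op k = o) :
    Step f o (S k) (S (k + 1)) :=
  ho ▸ h.step k

theorem s_pos (h : IsNondegenerateRun f mbar ε op S) (k : ℕ) (i : V) : 0 < (S k).s i :=
  h.pos.trans_le (h.le_s k i)

theorem realVal_add_le (h : IsNondegenerateRun f mbar ε op S)
    (hf : ∀ i, IsClosedProperConvex (f i)) {k : ℕ} (hfin : ∀ i, conj (f i) ((S k).z i) ≠ ⊤)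
    (i : V) :
    (S (k + 1)).realVal f + ε / 2 * ‖(S (k + 1)).xAll (node i) - (S k).xAll (node i)‖ ^ 2 ≤
      (S k).realVal f :=
  (h.step k).realVal_add_le hf (h.inv k) h.pos (h.le_s (k + 1)) hfin i

theorem realVal_succ_le (h : IsNondegenerateRun f mbar ε op S) [Nonempty V]
    (hf : ∀ i, IsClosedProperConvex (f i)) {k : ℕ} (hfin : ∀ i, conj (f i) ((S k).z i) ≠ ⊤) :
    (S (k + 1)).realVal f ≤ (S k).realVal f :=
  (le_add_of_nonneg_right (mul_nonneg (half_pos h.pos).le (sq_nonneg _))).trans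
    (h.realVal_add_le hf hfin (Classical.arbitrary V))

theorem antitone_Val [Nonempty V] (h : IsNondegenerateRun f mbar ε op S)
    (hf : ∀ i, IsClosedProperConvex (f i)) {zF : ℕ → pairs E → ProdSpace E m}
    (hz : ∀ k, Compatible mbar (S k) (zF k)) : Antitone fun k => Val f ((S k).tuple (zF k)) := by
  refine antitone_nat_of_succ_le fun k => ?_
  by_cases hfin : ∀ i, conj (f i) ((S k).z i) ≠ ⊤
  · have hfin' (i : V) : conj (f i) ((S (k + 1)).z i) ≠ ⊤ :=
      (h.step k).conj_ne_top (hf i) (h.s_pos k i) (hfin i)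
    rw [Val_eq_realVal hf (hz k) hfin, Val_eq_realVal hf (hz (k + 1)) hfin',
      EReal.coe_le_coe_iff]
    exact h.realVal_succ_le hf hfin
  · push Not at hfin
    obtain ⟨i, hi⟩ := hfin
    exact le_top.trans_eq (Val_eq_top hf (hz k) hi).symm

theorem norm_lag_succ_le (h : IsNondegenerateRun f mbar ε op S) (e : E) (k : ℕ) :
    ‖(S (k + 1)).lag e‖ ≤ ‖(S k).lag e‖ +
      Fintype.card V * ‖(S (k + 1)).xAll (node e.1.1) - (S k).xAll (node e.1.1)‖ := by
  by_cases ho : op k = .B e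
  · rw [(h.step_of_eq ho).lag_eq_zero, norm_zero]
    positivity
  · rw [(h.step k).lag_eq_sub (h.s_pos (k + 1) _).ne' ho]
    exact (norm_sub_le _ _).trans
      (add_le_add_right ((h.inv k).norm_weight_smul_le h.pos (.inr e) _) _)

end IsNondegenerateRun

namespace IsFairRun

theorem conj_ne_top (h : IsFairRun f mbar ε M K op S) {i : V} (hf : IsClosedProperConvex (f i))
    {k : ℕ} (hk : K ≤ k) : conj (f i) ((S k).z i) ≠ ⊤ := by
  obtain ⟨l, -, hlK, hl⟩ := h.recurs (.C i) 0
  have hlk : l + 1 ≤ k := by omega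
  clear hk
  induction k, hlk using Nat.le_induction with
  | base => exact ((h.step_of_eq hl).isSubgrad hf (h.s_pos l i)).conj_ne_top
  | succ k _ ih => exact (h.step k).conj_ne_top hf (h.s_pos k i) ih

theorem exists_tendsto_realVal [Nonempty V] (h : IsFairRun f mbar ε M K op S)
    (hf : ∀ i, IsClosedProperConvex (f i)) :
    ∃ L, Tendsto (fun k => (S k).realVal f) atTop (𝓝 L) := by
  choose x r hx using fun i => (hf i).exists_eq_coe
  have hfin (k : ℕ) (i : V) : conj (f i) ((S (k + K)).z i) ≠ ⊤ :=
    h.conj_ne_top (hf i) (Nat.le_add_left K k)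
  have hanti : Antitone fun k => (S (k + K)).realVal f := antitone_nat_of_succ_le fun k => by
    rw [Nat.add_right_comm]
    exact h.realVal_succ_le hf (hfin k)
  have hbdd : BddBelow (Set.range fun k => (S (k + K)).realVal f) := by
    refine ⟨∑ i, (-(‖x i‖ * M) - r i), ?_⟩
    rintro _ ⟨k, rfl⟩
    refine le_add_of_le_of_nonneg (Finset.sum_le_sum fun i _ => ?_)
      (Finset.sum_nonneg fun a _ => (h.inv (k + K)).kinetic_nonneg h.pos a)
    refine (sub_le_sub_right ?_ (r i)).trans (inner_sub_le_toReal_conj (hx i) (hfin k i))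
    refine neg_le_of_abs_le ((abs_real_inner_le_norm _ _).trans ?_)
    exact mul_le_mul_of_nonneg_left (h.norm_z_le _ i) (norm_nonneg _)
  exact ⟨_, (tendsto_add_atTop_iff_nat K).1 (tendsto_atTop_ciInf hanti hbdd)⟩

theorem tendsto_realVal_sub [Nonempty V] (h : IsFairRun f mbar ε M K op S)
    (hf : ∀ i, IsClosedProperConvex (f i)) :
    Tendsto (fun k => (S k).realVal f - (S (k + 1)).realVal f) atTop (𝓝 0) := by
  obtain ⟨L, hL⟩ := h.exists_tendsto_realVal hf
  simpa only [sub_self, Function.comp_def] using hL.sub (hL.comp (tendsto_add_atTop_nat 1))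

theorem tendsto_norm_xAll_succ_sub (h : IsFairRun f mbar ε M K op S)
    (hf : ∀ i, IsClosedProperConvex (f i)) (i : V) :
    Tendsto (fun k => ‖(S (k + 1)).xAll (node i) - (S k).xAll (node i)‖) atTop (𝓝 0) := by
  have : Nonempty V := ⟨i⟩
  refine squeeze_zero' (.of_forall fun k => norm_nonneg _) ?_
    (tendsto_sqrt_div (h.tendsto_realVal_sub hf) (ε / 2))
  filter_upwards [eventually_ge_atTop K] with k hk
  refine le_sqrt_div_of_mul_sq_le (half_pos h.pos) (le_sub_iff_add_le'.2 ?_)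
  exact h.realVal_add_le hf (fun i => h.conj_ne_top (hf i) hk) i

theorem tendsto_norm_lag (h : IsFairRun f mbar ε M K op S)
    (hf : ∀ i, IsClosedProperConvex (f i)) (e : E) :
    Tendsto (fun k => ‖(S k).lag e‖) atTop (𝓝 0) := by
  have hdrift := (h.tendsto_norm_xAll_succ_sub hf e.1.1).const_mul (Fintype.card V : ℝ)
  rw [mul_zero] at hdrift
  refine tendsto_zero_of_recurrent (K := K + 1) (b := 0) (fun k => norm_nonneg _)
    (h.norm_lag_succ_le e) hdrift tendsto_const_nhds (.of_forall fun k => ?_)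
  obtain ⟨l, hkl, hlK, hl⟩ := h.recurs (.B e) k
  refine ⟨l + 1, by omega, by omega, ?_⟩
  rw [(h.step_of_eq hl).lag_eq_zero, norm_zero, Pi.zero_apply]

theorem exists_receive (h : IsFairRun f mbar ε M K op S) (e : E) (k : ℕ) :
    ∃ l, k ≤ l ∧ l < k + 2 * K ∧ op l = .B e ∧ ε ≤ (S l).sAll (edge e) := by
  obtain ⟨l₀, hkl₀, hl₀K, hl₀⟩ := h.recurs (.A e.1.1) k
  obtain ⟨l, hl₀l, hlK, hl, hweight⟩ := (h.recurs (.B e)).exists_of_persists (k := l₀ + 1)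
    (P := fun l => ε ≤ (S l).sAll (edge e))
    ((h.step_of_eq hl₀).le_weight_edge (h.inv l₀) h.pos (h.le_s (l₀ + 1) _))
    fun l ho hl => hl.trans ((h.step l).weight_edge_le (h.s_pos (l + 1) _).le ho)
  exact ⟨l, by omega, by omega, hl, hweight⟩

theorem norm_sub_le_of_receive (h : IsFairRun f mbar ε M K op S) {e : E} {l : ℕ}
    (hl : op l = .B e) (he : ε ≤ (S l).sAll (edge e)) :
    ‖(S l).xAll (node e.1.1) - (S l).xAll (node e.1.2)‖ ≤ ‖(S l).lag e‖ / ε +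
      2 * √(((S l).realVal f - (S (l + 1)).realVal f) / (ε / 2)) := by
  have hdecrease := (h.step_of_eq hl).sq_norm_sub_le_of_receive (h.inv l) h.pos
    (h.le_s (l + 1) _) he
  have hnode := le_sqrt_div_of_mul_sq_le (half_pos h.pos) hdecrease.1
  have hedge := le_sqrt_div_of_mul_sq_le (half_pos h.pos) hdecrease.2
  have hsender : ‖(S l).xAll (edge e) - (S l).xAll (node e.1.1)‖ ≤ ‖(S l).lag e‖ / ε := by
    rw [le_div_iff₀' h.pos, (h.inv l).lag_eq h.pos, norm_smul,
      Real.norm_of_nonneg (h.pos.le.trans he)]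
    exact mul_le_mul_of_nonneg_right he (norm_nonneg _)
  rw [norm_sub_rev] at hsender hnode
  linarith [norm_sub_le_norm_sub_add_norm_sub ((S l).xAll (node e.1.1)) ((S l).xAll (edge e))
      ((S l).xAll (node e.1.2)),
    norm_sub_le_norm_sub_add_norm_sub ((S l).xAll (edge e)) ((S (l + 1)).xAll (node e.1.2))
      ((S l).xAll (node e.1.2))]

theorem tendsto_norm_xAll_sub_of_edge (h : IsFairRun f mbar ε M K op S)
    (hf : ∀ i, IsClosedProperConvex (f i)) (e : E) :
    Tendsto (fun k => ‖(S k).xAll (node e.1.1) - (S k).xAll (node e.1.2)‖) atTop (𝓝 0) := by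
  have : Nonempty V := ⟨e.1.1⟩
  have hdrift := (h.tendsto_norm_xAll_succ_sub hf e.1.1).add
    (h.tendsto_norm_xAll_succ_sub hf e.1.2)
  have hbound := ((h.tendsto_norm_lag hf e).div_const ε).add
    ((tendsto_sqrt_div (h.tendsto_realVal_sub hf) (ε / 2)).const_mul 2)
  rw [add_zero] at hdrift
  rw [zero_div, mul_zero, add_zero] at hbound
  refine tendsto_zero_of_recurrent (K := 2 * K) (fun k => norm_nonneg _) (fun k => ?_) hdrift
    hbound (.of_forall fun k => ?_)
  · have hsplit : (S (k + 1)).xAll (node e.1.1) - (S (k + 1)).xAll (node e.1.2) =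
        (S k).xAll (node e.1.1) - (S k).xAll (node e.1.2) +
          (((S (k + 1)).xAll (node e.1.1) - (S k).xAll (node e.1.1)) -
            ((S (k + 1)).xAll (node e.1.2) - (S k).xAll (node e.1.2))) := by abel
    rw [hsplit]
    exact (norm_add_le _ _).trans (add_le_add_right (norm_sub_le _ _) _)
  · obtain ⟨l, hkl, hlK, hl, he⟩ := h.exists_receive e k
    exact ⟨l, hkl, hlK, h.norm_sub_le_of_receive hl he⟩

theorem tendsto_xAll_sub (h : IsFairRun f mbar ε M K op S) (hE : StronglyConnected E)
    (hf : ∀ i, IsClosedProperConvex (f i)) (i j : V) :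
    Tendsto (fun k => (S k).xAll (node i) - (S k).xAll (node j)) atTop (𝓝 0) := by
  induction hE i j with
  | refl => simp only [sub_self, tendsto_const_nhds]
  | tail _ hedge ih =>
    have hstep := tendsto_zero_iff_norm_tendsto_zero.2
      (h.tendsto_norm_xAll_sub_of_edge hf ⟨_, hedge⟩)
    simpa only [sub_add_sub_cancel, add_zero] using ih.add hstep

theorem isSubgrad_lastProx (h : IsFairRun f mbar ε M K op S) {i : V}
    (hf : IsClosedProperConvex (f i)) {k : ℕ} (hk : K ≤ k) :
    IsSubgrad (f i) (lastProx op S i k) ((S k).z i) := by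
  obtain ⟨l, -, hlK, hl⟩ := h.recurs (.C i) 0
  have hlk : l + 1 ≤ k := by omega
  have hprox {l : ℕ} (hl : op l = .C i) :
      IsSubgrad (f i) (lastProx op S i (l + 1)) ((S (l + 1)).z i) := by
    rw [lastProx, if_pos hl]
    exact (h.step_of_eq hl).isSubgrad hf (h.s_pos l i)
  clear hk
  induction k, hlk using Nat.le_induction with
  | base => exact hprox hl
  | succ k _ ih =>
    by_cases ho : op k = .C i
    · exact hprox ho
    · rwa [lastProx, if_neg ho, (h.step k).z_eq ho]

theorem tendsto_lastProx_sub (h : IsFairRun f mbar ε M K op S)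
    (hf : ∀ i, IsClosedProperConvex (f i)) (i : V) :
    Tendsto (fun k => lastProx op S i k - (S k).xAll (node i)) atTop (𝓝 0) := by
  refine tendsto_zero_iff_norm_tendsto_zero.2 <| tendsto_zero_of_recurrent (K := K + 1) (b := 0)
    (fun k => norm_nonneg _) (fun k => ?_) (h.tendsto_norm_xAll_succ_sub hf i) tendsto_const_nhds
    (.of_forall fun k => ?_)
  · by_cases ho : op k = .C i
    · rw [lastProx, if_pos ho, sub_self, norm_zero]
      positivity
    · rw [lastProx, if_neg ho, norm_sub_rev ((S (k + 1)).xAll _)]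
      exact norm_sub_le_norm_sub_add_norm_sub _ _ _
  · obtain ⟨l, hkl, hlK, hl⟩ := h.recurs (.C i) k
    refine ⟨l + 1, by omega, by omega, ?_⟩
    rw [lastProx, if_pos hl, sub_self, norm_zero, Pi.zero_apply]

theorem tendsto_weight_smul_sub (h : IsFairRun f mbar ε M K op S)
    (hf : ∀ i, IsClosedProperConvex (f i)) {l : Filter ℕ} (hl : l ≤ atTop) {c : ℕ → Vec m}
    (hc : ∀ i, Tendsto (fun k => (S k).xAll (node i) - c k) l (𝓝 0)) (a : V ⊕ E) :
    Tendsto (fun k => ((S k).load a).1 • (center ((S k).load a) - c k)) l (𝓝 0) := by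
  have hbounded (b : V ⊕ E) (i : V) :
      Tendsto (fun k => ((S k).load b).1 • ((S k).xAll (node i) - c k)) l (𝓝 0) := by
    have hnorm := ((tendsto_zero_iff_norm_tendsto_zero.1 (hc i)).const_mul
      (Fintype.card V : ℝ))
    rw [mul_zero] at hnorm
    exact squeeze_zero_norm (fun k => (h.inv k).norm_weight_smul_le h.pos b _) hnorm
  rcases a with i | e
  · exact hbounded (.inl i) i
  · have hlag := (tendsto_zero_iff_norm_tendsto_zero.2 (h.tendsto_norm_lag hf e)).mono_left hl
    rw [← add_zero (0 : Vec m)]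
    refine (hlag.add (hbounded (.inr e) e.1.1)).congr fun k => ?_
    rw [(h.inv k).lag_eq h.pos]
    change _ + (S k).sAll (edge e) • _ = (S k).sAll (edge e) • ((S k).xAll (edge e) - _)
    rw [← smul_add, sub_add_sub_cancel]

theorem tendsto_xAll_sub_average (h : IsFairRun f mbar ε M K op S) (hE : StronglyConnected E)
    (hf : ∀ i, IsClosedProperConvex (f i)) (j : V) :
    Tendsto (fun k => (Fintype.card V : ℝ) • (mbar - (S k).xAll (node j)) - ∑ i, (S k).z i) atTop
      (𝓝 0) := by
  have hsum := tendsto_finsetSum Finset.univ fun a _ =>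
    h.tendsto_weight_smul_sub hf le_rfl (fun i => h.tendsto_xAll_sub hE hf i j) a
  simpa only [(h.inv _).sum_smul_center_sub h.pos, Finset.sum_const_zero] using hsum

theorem exists_cluster [Nonempty V] (h : IsFairRun f mbar ε M K op S) (hE : StronglyConnected E)
    (hf : ∀ i, IsClosedProperConvex (f i)) :
    ∃ (l : Filter ℕ) (x : Vec m) (z : V → Vec m), l.NeBot ∧ l ≤ atTop ∧
      (∀ i, Tendsto (fun k => (S k).z i) l (𝓝 (z i))) ∧
      (∀ i, Tendsto (fun k => (S k).xAll (node i)) l (𝓝 x)) ∧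
      ∑ i, z i = (Fintype.card V : ℝ) • (mbar - x) := by
  have hN : (Fintype.card V : ℝ) ≠ 0 := Nat.cast_ne_zero.2 Fintype.card_ne_zero
  have hcompact : IsCompact (Set.univ.pi fun _ : V => Metric.closedBall (0 : Vec m) M) :=
    isCompact_univ_pi fun _ => isCompact_closedBall 0 M
  obtain ⟨z, -, φ, hφ, hz⟩ := hcompact.tendsto_subseq (x := fun k => (S k).z) fun k i _ =>
    mem_closedBall_zero_iff.2 (h.norm_z_le k i)
  have hl : map φ atTop ≤ atTop := hφ.tendsto_atTop
  have hz (i : V) : Tendsto (fun k => (S k).z i) (map φ atTop) (𝓝 (z i)) :=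
    tendsto_map'_iff.2 (tendsto_pi_nhds.1 hz i)
  refine ⟨map φ atTop, mbar - (Fintype.card V : ℝ)⁻¹ • ∑ i, z i, z, inferInstance, hl, hz,
    fun j => ?_, ?_⟩
  · have hsum := tendsto_finsetSum Finset.univ fun i _ => hz i
    have hresidual := (h.tendsto_xAll_sub_average hE hf j).mono_left hl
    have hlimit := (tendsto_const_nhds (x := mbar)).sub
      ((hresidual.add hsum).const_smul (Fintype.card V : ℝ)⁻¹)
    simpa only [sub_add_cancel, inv_smul_smul₀ hN, sub_sub_cancel, zero_add] using hlimit
  · rw [sub_sub_cancel, smul_inv_smul₀ hN]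

theorem isPrimalDualPair_of_cluster (h : IsFairRun f mbar ε M K op S)
    (hf : ∀ i, IsClosedProperConvex (f i)) {l : Filter ℕ} [l.NeBot] (hl : l ≤ atTop) {x : Vec m}
    {z : V → Vec m} (hz : ∀ i, Tendsto (fun k => (S k).z i) l (𝓝 (z i)))
    (hx : ∀ i, Tendsto (fun k => (S k).xAll (node i)) l (𝓝 x))
    (hsum : ∑ i, z i = (Fintype.card V : ℝ) • (mbar - x)) : IsPrimalDualPair f mbar x z where
  isSubgrad i := by
    have hprox := ((h.tendsto_lastProx_sub hf i).mono_left hl).add (hx i)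
    simp only [sub_add_cancel, zero_add] at hprox
    refine (hf i).isSubgrad_of_tendsto hprox (hz i) (hl ?_)
    exact (eventually_ge_atTop K).mono fun k => h.isSubgrad_lastProx (hf i)
  sum_eq := hsum

theorem tendsto_fenchel_gap (h : IsFairRun f mbar ε M K op S) {i : V}
    (hf : ∀ i, IsClosedProperConvex (f i)) {l : Filter ℕ} (hl : l ≤ atTop) {x z : Vec m}
    (hsub : IsSubgrad (f i) x z) (hz : Tendsto (fun k => (S k).z i) l (𝓝 z))
    (hx : Tendsto (fun k => (S k).xAll (node i)) l (𝓝 x)) :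
    Tendsto (fun k => (conj (f i) ((S k).z i)).toReal + (f i x).toReal - inner ℝ x ((S k).z i)) l
      (𝓝 0) := by
  have hprox := (((h.tendsto_lastProx_sub hf i).mono_left hl).add hx).sub_const x
  simp only [sub_add_cancel, zero_add, sub_self] at hprox
  have hinner := hprox.inner (𝕜 := ℝ) (hz.sub_const z)
  rw [inner_zero_left] at hinner
  obtain ⟨r, hr, -⟩ := id hsub
  have hlate : ∀ᶠ k in l, K ≤ k := hl (eventually_ge_atTop K)
  refine tendsto_of_tendsto_of_tendsto_of_le_of_le' tendsto_const_nhds hinner ?_ ?_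
  · filter_upwards [hlate] with k hk
    rw [hr, EReal.toReal_coe]
    linarith [inner_sub_le_toReal_conj hr (h.conj_ne_top (hf i) hk)]
  · filter_upwards [hlate] with k hk
    exact (h.isSubgrad_lastProx (hf i) hk).fenchel_gap_le hsub

theorem tendsto_weight_mul_sq_norm (h : IsFairRun f mbar ε M K op S)
    (hf : ∀ i, IsClosedProperConvex (f i)) {l : Filter ℕ} (hl : l ≤ atTop) {x : Vec m}
    (hx : ∀ i, Tendsto (fun k => (S k).xAll (node i)) l (𝓝 x)) (a : V ⊕ E) :
    Tendsto (fun k => ((S k).load a).1 / 2 * ‖center ((S k).load a) - x‖ ^ 2) l (𝓝 0) := by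
  have hbound := ((h.tendsto_weight_smul_sub hf hl (c := fun _ => x)
    (fun i => tendsto_sub_nhds_zero_iff.2 (hx i)) a).norm.pow 2).div_const (2 * ε)
  rw [norm_zero, zero_pow two_ne_zero, zero_div] at hbound
  exact squeeze_zero
    (fun k => mul_nonneg (div_nonneg ((h.inv k).weight_nonneg h.pos a) zero_le_two) (sq_nonneg _))
    (fun k => (h.inv k).weight_mul_sq_norm_le h.pos a _) hbound

theorem tendsto_realVal_of_cluster (h : IsFairRun f mbar ε M K op S)
    (hf : ∀ i, IsClosedProperConvex (f i)) {l : Filter ℕ} (hl : l ≤ atTop) {x : Vec m}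
    {z : V → Vec m} (hpair : IsPrimalDualPair f mbar x z)
    (hz : ∀ i, Tendsto (fun k => (S k).z i) l (𝓝 (z i)))
    (hx : ∀ i, Tendsto (fun k => (S k).xAll (node i)) l (𝓝 x)) :
    Tendsto (fun k => (S k).realVal f) l (𝓝 (dualBound f mbar x)) := by
  have hgap := tendsto_finsetSum Finset.univ fun i _ =>
    h.tendsto_fenchel_gap hf hl (hpair.isSubgrad i) (hz i) (hx i)
  have hweighted := tendsto_finsetSum Finset.univ fun a _ =>
    h.tendsto_weight_mul_sq_norm hf hl hx a
  have hsum := ((tendsto_const_nhds (x := dualBound f mbar x)).add hgap).add hweighted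
  simp only [Finset.sum_const_zero, add_zero] at hsum
  exact hsum.congr fun k => ((h.inv k).realVal_eq h.pos f x).symm

theorem tendsto_xAll_of_tendsto_realVal (h : IsFairRun f mbar ε M K op S)
    (hf : ∀ i, IsClosedProperConvex (f i)) {x : Vec m} (hx : ∀ i, ∃ r : ℝ, f i x = r)
    (hval : Tendsto (fun k => (S k).realVal f) atTop (𝓝 (dualBound f mbar x))) (i : V) :
    Tendsto (fun k => (S k).xAll (node i)) atTop (𝓝 x) := by
  refine tendsto_iff_norm_sub_tendsto_zero.2 <| squeeze_zero' (.of_forall fun k => norm_nonneg _)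
    ?_ (tendsto_sqrt_div (tendsto_sub_nhds_zero_iff.2 hval) (ε / 2))
  filter_upwards [eventually_ge_atTop K] with k hk
  exact le_sqrt_div_of_mul_sq_le (half_pos h.pos)
    ((h.inv k).sq_norm_sub_le h.pos hx (fun i => h.conj_ne_top (hf i) hk) i)

theorem exists_isPrimalDualPair [Nonempty V] (h : IsFairRun f mbar ε M K op S)
    (hE : StronglyConnected E) (hf : ∀ i, IsClosedProperConvex (f i)) :
    ∃ x z, IsPrimalDualPair f mbar x z ∧
      Tendsto (fun k => (S k).realVal f) atTop (𝓝 (dualBound f mbar x)) := by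
  obtain ⟨l, x, z, _, hl, hz, hx, hsum⟩ := h.exists_cluster hE hf
  have hpair := h.isPrimalDualPair_of_cluster hf hl hz hx hsum
  obtain ⟨L, hL⟩ := h.exists_tendsto_realVal hf
  have hlimit : L = dualBound f mbar x :=
    tendsto_nhds_unique (hL.mono_left hl) (h.tendsto_realVal_of_cluster hf hl hpair hz hx)
  exact ⟨x, z, hpair, hlimit ▸ hL⟩

theorem tendsto_Val (h : IsFairRun f mbar ε M K op S) (hf : ∀ i, IsClosedProperConvex (f i))
    {zF : ℕ → pairs E → ProdSpace E m} (hz : ∀ k, Compatible mbar (S k) (zF k)) {L : ℝ}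
    (hL : Tendsto (fun k => (S k).realVal f) atTop (𝓝 L)) :
    Tendsto (fun k => Val f ((S k).tuple (zF k))) atTop (𝓝 (L : EReal)) := by
  refine ((continuous_coe_real_ereal.tendsto L).comp hL).congr' ?_
  filter_upwards [eventually_ge_atTop K] with k hk
  exact (Val_eq_realVal hf (hz k) fun i => h.conj_ne_top (hf i) hk).symm

end IsFairRun

end Runs

end DualAscent

theorem theorem3p3 {V : Type*} [Fintype V] [DecidableEq V] [Nonempty V]
    (E : Finset (V × V)) (hE : StronglyConnected E) (m : ℕ)
    (f : V → Vec m → EReal) (hf : ∀ i, IsClosedProperConvex (f i))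
    (xbar : V → Vec m)
    (op : ℕ → Op E) (S : ℕ → State E m) (hrun : IsRun f (mean xbar) op S)
    (ε : ℝ) (hε : 0 < ε) (hs : ∀ k i, ε < (S k).s i)
    (hz : ∃ M : ℝ, ∀ k i, ‖(S k).z i‖ ≤ M)
    (K : ℕ)
    (hA : ∀ k, ∀ i : V, ∃ l, k ≤ l ∧ l < k + K ∧ op l = Op.A i)
    (hC : ∀ k, ∀ i : V, ∃ l, k ≤ l ∧ l < k + K ∧ op l = Op.C i)
    (hB : ∀ k, ∀ e : E, ∃ l, k ≤ l ∧ l < k + K ∧ op l = Op.B e) :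
    (∀ k, ∃ zF : pairs E → ProdSpace E m, Compatible (mean xbar) (S k) zF ∧
      ∀ b : pairs E, none ∈ b.1 → zF b = 0) ∧
    (∀ zF : ℕ → pairs E → ProdSpace E m, (∀ k, Compatible (mean xbar) (S k) (zF k)) →
      Antitone (fun k => Val f ((S k).tuple (zF k))) ∧
      ∀ s : Idx E → ℝ, IsWeight s →
        Tendsto (fun k => Val f ((S k).tuple (zF k))) atTop
          (𝓝 (dualValue f (mean xbar) s))) ∧
    ∃ xstar : Vec m, primalObj f xbar xstar ≠ ⊤ ∧
      (∀ x, IsMinOn (primalObj f xbar) Set.univ x ↔ x = xstar) ∧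
      ∀ i, Tendsto (fun k => (S k).xAll (node i)) atTop (𝓝 xstar) := by
  obtain ⟨M, hM⟩ := hz
  have hfair : IsFairRun f (mean xbar) ε M K op S :=
    { hrun with
      pos := hε
      le_s := fun k i => (hs k i).le
      norm_z_le := hM
      recurs
        | .A i => fun k => hA k i
        | .B e => fun k => hB k e
        | .C i => fun k => hC k i }
  obtain ⟨x, z, hpair, hval⟩ := hfair.exists_isPrimalDualPair hE hf
  refine ⟨fun k => (hfair.inv k).exists_compatible hE, fun zF hzF => ⟨?_, fun s hs => ?_⟩,
    x, hpair.primalObj_ne_top, hpair.isMinOn_primalObj_iff, ?_⟩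
  · exact hfair.antitone_Val hf hzF
  · rw [hpair.dualValue_eq hE hs]
    exact hfair.tendsto_Val hf hzF hval
  · exact hfair.tendsto_xAll_of_tendsto_realVal hf (fun i => (hpair.isSubgrad i).imp fun _ h => h.1)
      hval
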